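/- **Setting.** An instance $(I,D)$ of the broadcaster-repacking problem (BRP) consists of a finite set $S\subset\mathbb N$ of stations, a family $D=(C_s)_{s\in S}$ of finite sets $C_s\subset\mathbb N$ (the domains), and a finite set $I$ of ordered pairs $((s_1,c_1),(s_2,c_2))$ with $s_1,s_2\in S$, $s_1\ne s_2$ and $c_1,c_2\in\mathbb N$ (the interference constraints). Put $C=\bigcup_{s\in S}C_s$. A complete, feasible assignment is a map $f:S\to C$ such that $f(s)\in C_s$ for all $s\in S$ and, for all $((s_1,c_1),(s_2,c_2))\in I$, $f(s_1)=c_1$ implies $f(s_2)\neq c_2$. The feasibility variant of the BRP is to return one if a complete, feasible assignment exists and zero otherwise. The constraint graph of $(I,D)$ is the simple graph $G$ with vertex set $\{(s,c)\in S\times C : c\in C_s\}$ in which $(s_1,c_1)$ and $(s_2,c_2)$ are adjacent if and only if $((s_1,c_1),(s_2,c_2))\in I$, or $((s_2,c_2),(s_1,c_1))\in I$, or $s_1=s_2$ and $c_1\neq c_2$. For a finite simple graph $G$ let $\alpha(G)$ be the largest cardinality of an independent set of vertices. The maximum independent set problem (MISP) has three variants: optimization (given $G$, find an independent set of cardinality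 $\alpha(G)$), evaluation (given $G$, compute $\alpha(G)$), and recognition (given $G$ and $k\in\mathbb N$, decide whether $\alpha(G)\ge k$). Time is counted on multi-stack Turing machines. An instance $(I,D)$ is given by the list of the stations with their domains and the list of the interference constraints, and a graph on $\{0,\dots,n-1\}$ by its adjacency matrix; a vertex set is given as a list of numbers, and all numbers are in binary. A polynomial-time reduction from a problem $A$ to a problem $B$ is a pair of polynomial-time computable functions $(F,g)$ such that $F$ maps instances $x$ of $A$ to instances of $B$ and, for every correct answer $y$ to $F(x)$, $g(x,y)$ is a correct answer to $x$. For decision problems, a many-one reduction is a polynomial-time computable $F$ such that $x$ is a yes-instance of $A$ if and only if $F(x)$ is a yes-instance of $B$. **Corollary.** The feasibility variant of the BRP has a polynomial-time reduction to the MISP. More precisely, there is a function $F$ that maps every BRP instance $(I,D)$ to a graph $F(I,D)$ on some vertex set $\{0,\dots,n-1\}$ which is isomorphic to the constraint graph of $(I,D)$, such that, with $S$ the set of stations of $(I,D)$: 1. $F$, followed by the comparison of $|U|$ with $|S|$ for the returned maximum independent set $U$ (answer one if and only if $|U|=|S|$), is a polynomial-time reduction to the optimization variant of the MISP; 2. $F$,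 followed by the comparison of the returned value $\alpha(F(I,D))$ with $|S|$ (answer one if and only if they are equal), is a polynomial-time reduction to the evaluation variant of the MISP; 3. $(I,D)\mapsto(F(I,D),|S|)$ is a polynomial-time many-one reduction to the recognition variant of the MISP. -/

import Mathlib

/-! ### Alphabet, encodings and polynomial time -/

/-- The alphabet in which inputs and outputs are written: two binary digits, a comma that ends a
number, and two brackets that enclose a list. -/
inductive Letter where
  | zero
  | one
  | comma
  | lbr
  | rbr
  deriving DecidableEq

instance : Fintype Letter where
  elems := {Letter.zero, Letter.one, Letter.comma, Letter.lbr, Letter.rbr}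
  complete x := by cases x <;> decide

/-- A bit as a letter. -/
def Letter.ofBool : Bool → Letter
  | false => Letter.zero
  | true => Letter.one

/-- A natural number in binary (least significant digit first), ended by a comma. -/
def encNat (n : ℕ) : List Letter :=
  n.bits.map Letter.ofBool ++ [Letter.comma]

/-- A list, written as the concatenation of the codes of its entries between brackets. -/
def encList {α : Type} (enc : α → List Letter) (l : List α) : List Letter :=
  Letter.lbr :: (l.flatMap enc ++ [Letter.rbr])

/-- A pair, written as the code of the first entry followed by that of the second. -/
def encPair {α β : Type} (encA : α → List Letter) (encB : β → List Letter) (p : α × β) : List Letter :=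
  encA p.1 ++ encB p.2

/-- A truth value, written as one bit. -/
def encBool (b : Bool) : List Letter :=
  [Letter.ofBool b]

/-- A finite set of natural numbers, listed in increasing order. -/
def encFinset (s : Finset ℕ) : List Letter :=
  encList encNat (s.sort (· ≤ ·))

/-- `f` is computed by a (multi-stack) Turing machine in time polynomial in the length of the
code of the input. -/
def PolyTime {α β : Type} (encA : α → List Letter) (encB : β → List Letter) (f : α → β) : Prop :=
  Nonempty (Turing.TM2ComputableInPolyTime encA encB f)

/-! ### Computational problems and reductions -/

/-- A computational problem: given an instance `x`, return some `y` with `IsAnswer x y`. -/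
structure Problem where
  Instance : Type
  Answer : Type
  encInstance : Instance → List Letter
  encAnswer : Answer → List Letter
  IsAnswer : Instance → Answer → Prop

/-- A decision problem: given an instance `x`, decide `Yes x`. -/
structure DecisionProblem where
  Instance : Type
  encInstance : Instance → List Letter
  Yes : Instance → Prop

/-- A decision problem as a problem whose only correct answer is `true` (one) on yes-instances
and `false` (zero) on all others. -/
def DecisionProblem.toProblem (A : DecisionProblem) : Problem where
  Instance := A.Instance
  Answer := Bool
  encInstance := A.encInstance
  encAnswer := encBool
  IsAnswer x b := b = true ↔ A.Yes x

/-- `(f, g)` is a polynomial-time reduction from `A` to `B`: the polynomial-time function `f` turns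
an instance `x` of `A` into an instance of `B`, and the polynomial-time function `g` turns `x` and
*any* correct answer for `f x` into a correct answer for `x`. -/
def IsPolyTimeReduction (A B : Problem) (f : A.Instance → B.Instance)
    (g : A.Instance × B.Answer → A.Answer) : Prop :=
  PolyTime A.encInstance B.encInstance f ∧
  PolyTime (encPair A.encInstance B.encAnswer) A.encAnswer g ∧
  ∀ x y, B.IsAnswer (f x) y → A.IsAnswer x (g (x, y))

/-- `f` is a polynomial-time many-one (Karp) reduction from `A` to `B`. -/
def IsPolyTimeManyOneReduction (A B : DecisionProblem) (f : A.Instance → B.Instance) : Prop :=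
  PolyTime A.encInstance B.encInstance f ∧ ∀ x, A.Yes x ↔ B.Yes (f x)

/-! ### The broadcaster-repacking problem -/

/-- The input data of a broadcaster-repacking problem: a finite set `S` of stations, the domain
`C_s` of every station, and a finite set `I` of interference constraints between different
stations. (The channels in `I` need not lie in the domains, so that lowering the clearing target
while keeping `I` gives an instance again.) -/
structure BRP where
  stations : Finset ℕ
  dom : ℕ → Finset ℕ
  interference : Finset ((ℕ × ℕ) × (ℕ × ℕ))
  dom_eq_empty : ∀ s, s ∉ stations → dom s = ∅
  left_mem : ∀ i ∈ interference, i.1.1 ∈ stations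
  right_mem : ∀ i ∈ interference, i.2.1 ∈ stations
  ne : ∀ i ∈ interference, i.1.1 ≠ i.2.1

namespace BRP

/-- The set `C` of channels, the union of all domains. -/
def channels (P : BRP) : Finset ℕ :=
  P.stations.biUnion P.dom

/-- The set of complete, feasible assignments `f : S → C`. -/
def BRPF (P : BRP) : Set (P.stations → P.channels) :=
  {f | (∀ s₁ s₂ : P.stations, ∀ c₁ c₂ : ℕ, (((s₁ : ℕ), c₁), ((s₂ : ℕ), c₂)) ∈ P.interference →
          (f s₁ : ℕ) = c₁ → (f s₂ : ℕ) ≠ c₂) ∧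
        ∀ s : P.stations, (f s : ℕ) ∈ P.dom s}

/-- The vertices of the constraint graph: the pairs `(s, c)` in `S × C` with `c ∈ C_s`. -/
def vertices (P : BRP) : Finset (ℕ × ℕ) :=
  (P.stations ×ˢ P.channels).filter fun v => v.2 ∈ P.dom v.1

/-- The constraint graph: its edges are the interference constraints, without their order,
between two vertices, and the at-most constraints, which join any two different vertices of the
same station. -/
def constraintGraph (P : BRP) : SimpleGraph P.vertices where
  Adj v w := ((v : ℕ × ℕ), (w : ℕ × ℕ)) ∈ P.interference ∨
    ((w : ℕ × ℕ), (v : ℕ × ℕ)) ∈ P.interference ∨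
    (v.1.1 = w.1.1 ∧ v.1.2 ≠ w.1.2)
  symm := ⟨by
    rintro v w (h | h | h)
    · exact Or.inr (Or.inl h)
    · exact Or.inl h
    · exact Or.inr (Or.inr ⟨h.1.symm, h.2.symm⟩)⟩
  loopless := ⟨by
    rintro v (h | h | h)
    · exact P.ne _ h rfl
    · exact P.ne _ h rfl
    · exact h.2 rfl⟩

/-- A station together with its domain. -/
def encStation (P : BRP) (s : ℕ) : List Letter :=
  encNat s ++ encFinset (P.dom s)

/-- The interference constraints, listed in lexicographic order. -/
def interferenceList (P : BRP) : List ((ℕ × ℕ) × (ℕ × ℕ)) :=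
  ((P.interference.image fun i => toLex (toLex i.1, toLex i.2)).sort (· ≤ ·)).map
    fun i => (ofLex (ofLex i).1, ofLex (ofLex i).2)

/-- The code of the input `(I, D)`: the list of the stations with their domains, followed by the
list of the interference constraints; all names of stations and channels are in binary. -/
def encode (P : BRP) : List Letter :=
  encList P.encStation (P.stations.sort (· ≤ ·)) ++
    encList (encPair (encPair encNat encNat) (encPair encNat encNat)) P.interferenceList

end BRP

/-- The feasibility variant of the broadcaster-repacking problem: return one if there is a
complete, feasible assignment, and zero otherwise. -/
def brpFeasibility : DecisionProblem where
  Instance := BRP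
  encInstance := BRP.encode
  Yes P := P.BRPF.Nonempty

/-! ### The maximum independent set problem -/

/-- A finite simple graph with the vertices `0, …, order - 1`. -/
structure FinGraph where
  order : ℕ
  graph : SimpleGraph (Fin order)

open Classical in
/-- The code of a graph: its adjacency matrix, as the list of its rows. -/
noncomputable def FinGraph.encode (G : FinGraph) : List Letter :=
  encList (fun i : Fin G.order =>
      encList (fun j : Fin G.order => encBool (decide (G.graph.Adj i j))) (List.finRange G.order))
    (List.finRange G.order)

/-- Optimization variant: find a maximum independent set. -/
noncomputable def mispOptimization : Problem where
  Instance := FinGraph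
  Answer := Finset ℕ
  encInstance := FinGraph.encode
  encAnswer := encFinset
  IsAnswer G U := ∃ T : Finset (Fin G.order),
    G.graph.IsIndepSet T ∧ T.card = G.graph.indepNum ∧ U = T.map Fin.valEmbedding

/-- Evaluation variant: compute the independence number. -/
noncomputable def mispEvaluation : Problem where
  Instance := FinGraph
  Answer := ℕ
  encInstance := FinGraph.encode
  encAnswer := encNat
  IsAnswer G a := a = G.graph.indepNum

/-- Recognition variant: given a graph and `k`, decide whether the independence number is at
least `k`. -/
noncomputable def mispRecognition : DecisionProblem where
  Instance := FinGraph × ℕ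
  encInstance := encPair FinGraph.encode encNat
  Yes x := x.2 ≤ x.1.graph.indepNum

/-! ### Structured programs on stacks and their compilation to Turing machines -/

/-! The combinatorial core is short. The at-most constraints turn the vertices of each station into
a clique, so an independent set of the constraint graph has at most one vertex per station and
`indepNum` never exceeds the number of stations. The graph of a feasible assignment is an
independent set meeting every station; conversely, an independent set with as many vertices as there
are stations selects exactly one channel for each, and independence rules out interference. Hence
feasibility means that `indepNum` equals the number of stations (`BRP.indepNum_le`,
`BRP.feasible_iff`), which gives the correctness of all three reductions.

Most of the work is polynomial time on actual machines. Structured programs carry a cost semantics,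
`Runs`, and compile to stack machines with the same time bound (`Runs.evalsToInTime`,
`StackProg.polyTime`). On top of them, `Impl` describes polynomial-time word functions whose
programs preserve their arguments. This class is closed under concatenation, transducers, binary
length, case distinction on equality of words, and iteration over the bracket-terminated pieces of a
word (`Impl.forIn`). A loop body sees only the arguments and the current piece, never earlier
output, so nested loops compose their polynomial bounds without blow-up.

The adjacency matrix is then four nested loops, over the station and the channel of either vertex,
with a search through the constraints inside; `BRP.matrix_encode` identifies the resulting word with
the code of the numbered constraint graph. The answer maps strip the instance off the input, count,
and compare binary codes. -/

/-- Structured programs acting on stacks of letters that are named by `K`. The instruction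
`popCase k p` pops a letter from `k` and continues according to the result; `loop k n q step body`
pops letters from `k` until it is empty and runs `body q a` after popping `a` in state `q`. -/
inductive StackProg (K : Type)
  | skip : StackProg K
  | push (k : K) (a : Letter) : StackProg K
  | seq (p q : StackProg K) : StackProg K
  | popCase (k : K) (p : Option Letter → StackProg K) : StackProg K
  | loop (k : K) (n : ℕ) (q : Fin n) (step : Fin n → Letter → Fin n)
      (body : Fin n → Letter → StackProg K) : StackProg K

namespace StackProg

open Turing Function StateTransition

variable {K : Type}

/-- The labels of the Turing machine program for `p`. -/
def Label : StackProg K → Type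
  | skip => Unit
  | push _ _ => Unit
  | seq p q => Label p ⊕ Label q
  | popCase _ p => Unit ⊕ Σ a, Label (p a)
  | loop _ n _ _ body => Fin n ⊕ Σ (q : Fin n) (a : Letter), Label (body q a)

instance finite_label : ∀ p : StackProg K, Finite (Label p)
  | skip => inferInstanceAs (Finite Unit)
  | push _ _ => inferInstanceAs (Finite Unit)
  | seq p q =>
    have := finite_label p
    have := finite_label q
    inferInstanceAs (Finite (Label p ⊕ Label q))
  | popCase _ p =>
    have := fun a => finite_label (p a)
    inferInstanceAs (Finite (Unit ⊕ Σ a, Label (p a)))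
  | loop _ n _ _ body =>
    have := fun q a => finite_label (body q a)
    inferInstanceAs (Finite (Fin n ⊕ Σ (q : Fin n) (a : Letter), Label (body q a)))

/-- The label at which a program starts. -/
def entry : (p : StackProg K) → Label p
  | skip => ()
  | push _ _ => ()
  | seq p _ => Sum.inl (entry p)
  | popCase _ _ => Sum.inl ()
  | loop _ _ q _ _ => Sum.inl q

/-- The Turing machine program for `p`, where `r` translates the names of the stacks, `emb` embeds
the labels and `exit` is the label to go to at the end. -/
def code {K' Λ : Type} (r : K → K') : (p : StackProg K) → (emb : Label p → Λ) → (exit : Λ) →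
    Label p → TM2.Stmt (fun _ : K' => Letter) Λ (Option Letter)
  | skip, _, exit, _ => .goto fun _ => exit
  | push k a, _, exit, _ => .push (r k) (fun _ => a) (.goto fun _ => exit)
  | seq p q, emb, _, Sum.inl l =>
    code r p (fun l => emb (Sum.inl l)) (emb (Sum.inr (entry q))) l
  | seq _ q, emb, exit, Sum.inr l => code r q (fun l => emb (Sum.inr l)) exit l
  | popCase k p, emb, _, Sum.inl () =>
    .pop (r k) (fun _ a => a) (.goto fun a => emb (Sum.inr ⟨a, entry (p a)⟩))
  | popCase _ p, emb, exit, Sum.inr ⟨a, l⟩ =>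
    code r (p a) (fun l => emb (Sum.inr ⟨a, l⟩)) exit l
  | loop k _ _ _ body, emb, exit, Sum.inl q =>
    .pop (r k) (fun _ a => a) (.goto fun a =>
      a.elim exit fun a => emb (Sum.inr ⟨q, a, entry (body q a)⟩))
  | loop _ _ _ step body, emb, _, Sum.inr ⟨q, a, l⟩ =>
    code r (body q a) (fun l => emb (Sum.inr ⟨q, a, l⟩)) (emb (Sum.inl (step q a))) l

variable [DecidableEq K]

/-- The names of the stacks that occur in a program. -/
def support : StackProg K → Finset K
  | skip => ∅
  | push k _ => {k}
  | seq p q => support p ∪ support q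
  | popCase k p => insert k (Finset.univ.biUnion fun a => support (p a))
  | loop k _ _ _ body =>
    insert k (Finset.univ.biUnion fun q => Finset.univ.biUnion fun a => support (body q a))

/-- `Runs p S t S'`: started with the stacks `S`, the program `p` ends with the stacks `S'` after
at most `t` steps. -/
inductive Runs : StackProg K → (K → List Letter) → ℕ → (K → List Letter) → Prop
  | skip (S) : Runs skip S 1 S
  | push (k a S) : Runs (push k a) S 1 (update S k (a :: S k))
  | seq {p q S₁ S₂ S₃ t₁ t₂} (h₁ : Runs p S₁ t₁ S₂) (h₂ : Runs q S₂ t₂ S₃) :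
      Runs (seq p q) S₁ (t₁ + t₂) S₃
  | popCase {k p S S' t} (h : Runs (p (S k).head?) (update S k (S k).tail) t S') :
      Runs (popCase k p) S (t + 1) S'
  | loop_nil {k n q step body S} (h : S k = []) : Runs (loop k n q step body) S 1 S
  | loop_cons {k n q step body S S₁ S₂ a x t₁ t₂} (h : S k = a :: x)
      (h₁ : Runs (body q a) (update S k x) t₁ S₁)
      (h₂ : Runs (loop k n (step q a) step body) S₁ t₂ S₂) :
      Runs (loop k n q step body) S (t₁ + t₂ + 1) S₂
  | weaken {p S S' t t'} (h : Runs p S t S') (ht : t ≤ t') : Runs p S t' S'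

theorem evalsToInTime_one {σ : Type*} {f : σ → Option σ} {a b : σ} (h : f a = some b) :
    Nonempty (EvalsToInTime f a (some b) 1) :=
  ⟨⟨⟨1, h⟩, le_rfl⟩⟩

theorem evalsToInTime_trans {σ : Type*} {f : σ → Option σ} {a b : σ} {c : Option σ} {m n : ℕ}
    (h₁ : Nonempty (EvalsToInTime f a (some b) m)) (h₂ : Nonempty (EvalsToInTime f b c n)) :
    Nonempty (EvalsToInTime f a c (m + n)) := by
  obtain ⟨h₁⟩ := h₁
  obtain ⟨h₂⟩ := h₂
  rw [add_comm]
  exact ⟨EvalsToInTime.trans f _ _ _ _ _ h₁ h₂⟩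

theorem evalsToInTime_mono {σ : Type*} {f : σ → Option σ} {a : σ} {b : Option σ} {m n : ℕ}
    (h : Nonempty (EvalsToInTime f a b m)) (hmn : m ≤ n) : Nonempty (EvalsToInTime f a b n) :=
  h.map fun h => ⟨h.toEvalsTo, h.steps_le_m.trans hmn⟩

/-- The compiled program runs as the structured program does. -/
theorem Runs.evalsToInTime {K' Λ : Type} [DecidableEq K'] {r : K → K'} {i : K' → K}
    {M : Λ → TM2.Stmt (fun _ : K' => Letter) Λ (Option Letter)} (hi : ∀ k, r (i k) = k)
    {p : StackProg K} {S S' : K → List Letter} {t : ℕ} (h : Runs p S t S') :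
    ∀ (_ : ∀ k ∈ p.support, i (r k) = k) (emb : Label p → Λ) (exit : Λ)
      (_ : ∀ l, M (emb l) = code r p emb exit l) (v : Option Letter),
      ∃ v', Nonempty (EvalsToInTime (TM2.step M) ⟨some (emb (entry p)), v, S ∘ i⟩
        (some ⟨some exit, v', S' ∘ i⟩) t) := by
  -- The machine sees the stacks only through the injection `i`; on every stack that the program
  -- uses, restricting along `i` commutes with updating.
  have upd : ∀ (S : K → List Letter) k x, i (r k) = k →
      update (S ∘ i) (r k) x = update S k x ∘ i := by
    intro S k x hk
    funext j
    by_cases hj : j = r k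
    · subst hj; simp [hk]
    · have : i j ≠ k := fun e => hj (by rw [← e, hi])
      simp [hj, this]
  induction h with
  | skip S =>
    intro _ emb exit hM v
    exact ⟨v, evalsToInTime_one (by simp [entry, TM2.step, hM (), code])⟩
  | push k a S =>
    intro hr emb exit hM v
    have hk := hr k (by simp [support])
    exact ⟨v, evalsToInTime_one (by simp [entry, TM2.step, hM (), code, hk, upd])⟩
  | @seq p q S₁ S₂ S₃ t₁ t₂ h₁ h₂ ih₁ ih₂ =>
    intro hr emb exit hM v
    simp only [support, Finset.mem_union] at hr
    obtain ⟨v₁, e₁⟩ := ih₁ (fun k hk => hr k (.inl hk)) (fun l => emb (Sum.inl l))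
      (emb (Sum.inr (entry q))) (fun l => hM (Sum.inl l)) v
    obtain ⟨v₂, e₂⟩ := ih₂ (fun k hk => hr k (.inr hk)) (fun l => emb (Sum.inr l))
      exit (fun l => hM (Sum.inr l)) v₁
    exact ⟨v₂, evalsToInTime_trans e₁ e₂⟩
  | @popCase k p S S' t h ih =>
    intro hr emb exit hM v
    simp only [support, Finset.mem_insert, Finset.mem_biUnion, Finset.mem_univ, true_and] at hr
    have hk := hr k (.inl rfl)
    obtain ⟨v₁, e₁⟩ := ih (fun k hk => hr k (.inr ⟨_, hk⟩))
      (fun l => emb (Sum.inr ⟨(S k).head?, l⟩)) exit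
      (fun l => hM (Sum.inr ⟨(S k).head?, l⟩)) (S k).head?
    refine ⟨v₁, ?_⟩
    rw [add_comm]
    refine evalsToInTime_trans (evalsToInTime_one ?_) e₁
    have := hM (Sum.inl ())
    simp [entry, TM2.step, this, code, hk, upd]
  | @loop_nil k n q step body S h =>
    intro hr emb exit hM v
    have hk := hr k (by simp [support])
    refine ⟨none, evalsToInTime_one ?_⟩
    have : update S k [] = S := by rw [← h, update_eq_self]
    have hl := hM (Sum.inl q)
    simp [entry, TM2.step, hl, code, hk, upd, h, this]
  | @loop_cons k n q step body S S₁ S₂ a x t₁ t₂ h h₁ h₂ ih₁ ih₂ =>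
    intro hr emb exit hM v
    have hr' := hr
    simp only [support, Finset.mem_insert, Finset.mem_biUnion, Finset.mem_univ, true_and] at hr
    have hk := hr k (.inl rfl)
    obtain ⟨v₁, e₁⟩ := ih₁ (fun k hk => hr k (.inr ⟨_, _, hk⟩))
      (fun l => emb (Sum.inr ⟨q, a, l⟩)) (emb (Sum.inl (step q a)))
      (fun l => hM (Sum.inr ⟨q, a, l⟩)) (some a)
    -- The label type of a loop does not depend on its current state, so the remaining iterations
    -- run in the same code with the same `emb`.
    obtain ⟨v₂, e₂⟩ := ih₂ hr' emb exit
      (fun l => by rcases l with l | ⟨q, a, l⟩; exacts [hM (Sum.inl l), hM (Sum.inr ⟨q, a, l⟩)]) v₁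
    refine ⟨v₂, ?_⟩
    rw [add_comm]
    refine evalsToInTime_trans (evalsToInTime_one ?_) (evalsToInTime_trans e₁ e₂)
    have hl := hM (Sum.inl q)
    simp [entry, TM2.step, hl, code, hk, upd, h]
  | weaken h ht ih =>
    intro hr emb exit hM v
    obtain ⟨v', e⟩ := ih hr emb exit hM v
    exact ⟨v', evalsToInTime_mono e ht⟩

/-- A function computed by a structured program in polynomial time is computable in polynomial
time. -/
theorem polyTime {α β : Type} {encA : α → List Letter} {encB : β → List Letter} {f : α → β}
    (p : StackProg K) (k₀ k₁ : K) (time : Polynomial ℕ)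
    (h : ∀ a, Runs p (update (fun _ => []) k₀ (encA a)) (time.eval (encA a).length)
      (update (fun _ => []) k₁ (encB (f a)))) : PolyTime encA encB f := by
  classical
  -- A machine has finitely many stacks while `K` may be infinite, so only the stacks in use are
  -- kept. The value `k₀` of `r` outside `T` is never used.
  let T : Finset K := insert k₀ (insert k₁ p.support)
  let r : K → T := fun k => if h : k ∈ T then ⟨k, h⟩ else ⟨k₀, by simp [T]⟩
  have hr : ∀ k ∈ T, (r k : K) = k := fun k hk => by simp [r, hk]
  let _ := Fintype.ofFinite (Label p)
  -- The extra label `none` is the exit. It resets the internal state before halting, as `haltList`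
  -- demands, and costs the one additional step in `time + 1`.
  let M : Option (Label p) → TM2.Stmt (fun _ : T => Letter) (Option (Label p)) (Option Letter) :=
    fun l => l.elim (.load (fun _ => none) .halt) fun l => code r p some none l
  let tm : FinTM2 :=
    { K := T, k₀ := ⟨k₀, by simp [T]⟩, k₁ := ⟨k₁, by simp [T]⟩, Γ := fun _ => Letter
      Λ := Option (Label p), main := some (entry p), σ := Option Letter, initialState := none
      Γk₀Fin := inferInstanceAs (Fintype Letter), m := M }
  have key : ∀ a, Nonempty (EvalsToInTime (TM2.step M)
      ⟨some (some (entry p)), none, update (fun _ => []) k₀ (encA a) ∘ Subtype.val⟩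
      (some ⟨none, none, update (fun _ => []) k₁ (encB (f a)) ∘ Subtype.val⟩)
      ((time + 1).eval (encA a).length)) := by
    intro a
    obtain ⟨v, e⟩ := (h a).evalsToInTime (r := r) (i := Subtype.val) (M := M)
      (fun k => Subtype.ext (hr k k.2)) (fun k hk => hr k (by simp [T, hk])) some none
      (fun l => rfl) none
    rw [Polynomial.eval_add, Polynomial.eval_one]
    exact evalsToInTime_trans e (evalsToInTime_one (by simp [TM2.step, M]))
  refine ⟨⟨⟨tm, Equiv.refl _, Equiv.refl _⟩, time + 1, fun a => ?_⟩⟩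
  have hI : initList tm (List.map (Equiv.refl Letter).invFun (encA a)) =
      ⟨some (some (entry p)), none, update (fun _ => []) k₀ (encA a) ∘ Subtype.val⟩ := by
    unfold initList
    congr 1
    funext k
    by_cases hk : k = ⟨k₀, by simp [T]⟩
    · subst hk; simp [tm]
    · have : (k : K) ≠ k₀ := fun e => hk (Subtype.ext e)
      simp [tm, hk, this]
  have hO : haltList tm (List.map (Equiv.refl Letter).invFun (encB (f a))) =
      ⟨none, none, update (fun _ => []) k₁ (encB (f a)) ∘ Subtype.val⟩ := by
    unfold haltList
    congr 1
    funext k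
    by_cases hk : k = ⟨k₁, by simp [T]⟩
    · subst hk; simp [tm]
    · have : (k : K) ≠ k₁ := fun e => hk (Subtype.ext e)
      simp [tm, hk, this]
  have := (key a).some
  rw [← hI, ← hO] at this
  exact this

end StackProg

/-! ### Finite-state transducers -/

/-- A sequential transducer with states `Fin n`: reading `a` in state `q`, it writes `out q a` and
goes to the state `step q a`. -/
structure Transducer where
  n : ℕ
  start : Fin n
  step : Fin n → Letter → Fin n
  out : Fin n → Letter → List Letter

namespace Transducer

/-- The output of a transducer that is started in state `q`. -/
def runFrom (T : Transducer) : Fin T.n → List Letter → List Letter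
  | _, [] => []
  | q, a :: x => T.out q a ++ T.runFrom (T.step q a) x

/-- The output of a transducer. -/
def run (T : Transducer) (x : List Letter) : List Letter :=
  T.runFrom T.start x

/-- A bound for the number of letters that are written per letter read. -/
def bound (T : Transducer) : ℕ :=
  ∑ q, ∑ a, (T.out q a).length

theorem length_out_le (T : Transducer) (q : Fin T.n) (a : Letter) :
    (T.out q a).length ≤ T.bound :=
  (Finset.single_le_sum (f := fun a => (T.out q a).length) (fun _ _ => Nat.zero_le _)
    (Finset.mem_univ a)).trans
    (Finset.single_le_sum (f := fun q => ∑ a, (T.out q a).length) (fun _ _ => Nat.zero_le _)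
      (Finset.mem_univ q))

theorem length_runFrom_le (T : Transducer) (q : Fin T.n) (x : List Letter) :
    (T.runFrom q x).length ≤ T.bound * x.length := by
  induction x generalizing q with
  | nil => simp [runFrom]
  | cons a x ih =>
    have := T.length_out_le q a
    have := ih (T.step q a)
    simp only [runFrom, List.length_append, List.length_cons]
    linarith

/-- The transducer with a single state that replaces each letter by a word. -/
def ofLetters (f : Letter → List Letter) : Transducer where
  n := 1
  start := 0
  step q _ := q
  out _ := f

@[simp]
theorem run_ofLetters (f : Letter → List Letter) (x : List Letter) :
    (ofLetters f).run x = x.flatMap f := by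
  suffices ∀ q, (ofLetters f).runFrom q x = x.flatMap f from this _
  induction x with
  | nil => simp [runFrom]
  | cons a x ih => intro q; simp [runFrom, ih]; rfl

/-- The transducer that increments a binary number. -/
def increment : Transducer where
  n := 2
  start := 1
  step q a := if q = 1 ∧ a = .one then 1 else 0
  out q a := if q = 1 then
      match a with
      | .one => [.zero]
      | .comma => [.one, .comma]
      | _ => [.one]
    else [a]

theorem runFrom_increment_zero (x : List Letter) : increment.runFrom (0 : Fin 2) x = x := by
  induction x with
  | nil => rfl
  | cons a x ih =>
    have h0 : increment.step (0 : Fin 2) a = (0 : Fin 2) := by simp [increment]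
    have h1 : increment.out (0 : Fin 2) a = [a] := by simp [increment]
    change increment.out (0 : Fin 2) a ++ increment.runFrom (increment.step (0 : Fin 2) a) x = _
    rw [h0, h1, ih]
    rfl

/-- With the least significant digit first, the carry travels in the reading direction. State `1` is
a pending carry: a digit one becomes zero and passes it on, a digit zero absorbs it, and the comma
turns it into a new leading digit. -/
theorem run_increment (n : ℕ) : increment.run (encNat n) = encNat (n + 1) := by
  induction n using Nat.binaryRec' with
  | zero => rfl
  | bit b n h ih =>
    rw [encNat, Nat.bits_append_bit n b h]
    cases b
    · rw [show Nat.bit false n + 1 = Nat.bit true n by simp [Nat.bit], encNat,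
        Nat.bits_append_bit n true (by simp)]
      exact congrArg (Letter.one :: ·) (runFrom_increment_zero _)
    · rw [show Nat.bit true n + 1 = Nat.bit false (n + 1) by simp [Nat.bit]; ring, encNat,
        Nat.bits_append_bit (n + 1) false (by simp)]
      exact congrArg (Letter.zero :: ·) ih

end Transducer

/-- This crude bound is enough because it is applied only to counters, whose values are bounded by
the length of a word already on a stack. -/
theorem length_encNat_le (n : ℕ) : (encNat n).length ≤ n + 1 := by
  have : n.size ≤ n := Nat.size_le.2 n.lt_two_pow_self
  simpa [encNat, Nat.size_eq_bits_len] using this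

/-- The pieces of a word that are ended by a closing bracket, preceded by `acc`. -/
def chunksFrom : List Letter → List Letter → List (List Letter)
  | _, [] => []
  | acc, a :: x => if a = .rbr then acc :: chunksFrom [] x else chunksFrom (acc ++ [a]) x

/-- The pieces of a word that are ended by a closing bracket, without these brackets. -/
def chunks (x : List Letter) : List (List Letter) :=
  chunksFrom [] x

theorem chunksFrom_append_rbr (acc x y : List Letter) (hx : Letter.rbr ∉ x) :
    chunksFrom acc (x ++ Letter.rbr :: y) = (acc ++ x) :: chunks y := by
  induction x generalizing acc with
  | nil => simp [chunksFrom, chunks]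
  | cons a x ih =>
    simp only [List.mem_cons, not_or] at hx
    simp [chunksFrom, Ne.symm hx.1, ih _ hx.2]

theorem chunks_flatMap {α : Type} (l : List α) (f : α → List Letter)
    (hf : ∀ a ∈ l, Letter.rbr ∉ f a) :
    chunks (l.flatMap fun a => f a ++ [Letter.rbr]) = l.map f := by
  induction l with
  | nil => rfl
  | cons a l ih =>
    simp only [List.mem_cons, forall_eq_or_imp] at hf
    simp [chunks, chunksFrom_append_rbr _ _ _ hf.1] at ih ⊢
    exact ih hf.2

/-! ### Basic programs -/

namespace StackProg

open Function

variable {K : Type}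

/-- Push a word, its first letter first. -/
def pushAll (k : K) : List Letter → StackProg K
  | [] => skip
  | a :: x => seq (push k a) (pushAll k x)

/-- Apply a transducer to the stack `k` and push its output to the stack `k'`. -/
def transduce (T : Transducer) (q : Fin T.n) (k k' : K) : StackProg K :=
  loop k T.n q T.step fun q a => pushAll k' (T.out q a)

/-- Empty the stack `k` onto the stack `k'`. -/
def move (k k' : K) : StackProg K :=
  transduce (.ofLetters fun a => [a]) (Transducer.start _) k k'

/-- Empty the stack `k`. -/
def clear (k : K) : StackProg K :=
  loop k 1 0 (fun q _ => q) fun _ _ => skip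

/-- Empty the stack `k` onto the stacks `k₁` and `k₂`. -/
def moveTwo (k k₁ k₂ : K) : StackProg K :=
  loop k 1 0 (fun q _ => q) fun _ a => seq (push k₁ a) (push k₂ a)

variable [DecidableEq K]

theorem runs_pushAll (k : K) (x : List Letter) (S : K → List Letter) :
    Runs (pushAll k x) S (x.length + 1) (update S k (x.reverse ++ S k)) := by
  induction x generalizing S with
  | nil => simpa [pushAll] using Runs.skip S
  | cons a x ih =>
    refine Runs.weaken (t := 1 + (x.length + 1)) ?_ (by simp; omega)
    convert! Runs.seq (Runs.push k a S) (ih _) using 1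
    simp

/-- Pushing reverses the output. Each letter costs one step for the pop and at most `T.bound + 1`
for `pushAll`. -/
theorem runs_transduce (T : Transducer) (q : Fin T.n) {k k' : K} (hk : k ≠ k')
    (S : K → List Letter) :
    Runs (transduce T q k k') S ((T.bound + 2) * (S k).length + 1)
      (update (update S k' ((T.runFrom q (S k)).reverse ++ S k')) k []) := by
  generalize hx : S k = x
  induction x generalizing q S with
  | nil =>
    have : update (update S k' ((T.runFrom q []).reverse ++ S k')) k [] = S := by
      simp only [Transducer.runFrom, List.reverse_nil, List.nil_append, update_eq_self]
      rw [← hx, update_eq_self]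
    rw [this]
    exact Runs.weaken (Runs.loop_nil hx) (by simp)
  | cons a x ih =>
    have h₁ := runs_pushAll k' (T.out q a) (update S k x)
    have h₂ := ih (T.step q a) _ (show update (update S k x) k'
      ((T.out q a).reverse ++ update S k x k') k = x by simp [hk])
    refine Runs.weaken (t := (T.out q a).length + 1 + ((T.bound + 2) * x.length + 1) + 1) ?_ ?_
    · convert! Runs.loop_cons hx h₁ h₂ using 1
      funext r
      by_cases hr : r = k
      · subst hr; simp
      by_cases hr' : r = k'
      · subst hr'; simp [hr, Transducer.runFrom]
      simp [hr, hr']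
    · have := T.length_out_le q a
      simp only [List.length_cons]
      linarith

theorem runs_move {k k' : K} (hk : k ≠ k') (S : K → List Letter) :
    Runs (move k k') S (7 * (S k).length + 1)
      (update (update S k' ((S k).reverse ++ S k')) k []) := by
  have h := runs_transduce (Transducer.ofLetters fun a => [a]) (Transducer.start _) hk S
  -- `bound` sums over the alphabet, so the identity transducer has bound five, one for each letter.
  have hb : (Transducer.ofLetters fun a => [a]).bound = 5 := rfl
  have hr := Transducer.run_ofLetters (fun a => [a]) (S k)
  rw [Transducer.run, List.flatMap_singleton'] at hr
  rwa [hr, hb] at h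

theorem runs_clear (k : K) (S : K → List Letter) :
    Runs (clear k) S (2 * (S k).length + 1) (update S k []) := by
  generalize hx : S k = x
  induction x generalizing S with
  | nil =>
    rw [← hx, update_eq_self]
    exact Runs.weaken (Runs.loop_nil hx) (by simp)
  | cons a x ih =>
    refine Runs.weaken (t := 1 + (2 * x.length + 1) + 1) ?_ (by simp; omega)
    convert! Runs.loop_cons (n := 1) (q := 0) (step := fun q _ => q) (body := fun _ _ => skip) hx
      (Runs.skip _) (ih _ (update_self k x S)) using 1
    simp

theorem runs_moveTwo {k k₁ k₂ : K} (h₁ : k ≠ k₁) (h₂ : k ≠ k₂) (h₁₂ : k₁ ≠ k₂)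
    (S : K → List Letter) :
    Runs (moveTwo k k₁ k₂) S (3 * (S k).length + 1)
      (update (update (update S k₁ ((S k).reverse ++ S k₁)) k₂ ((S k).reverse ++ S k₂)) k []) := by
  generalize hx : S k = x
  induction x generalizing S with
  | nil =>
    have : update S k [] = S := by rw [← hx, update_eq_self]
    simp only [List.reverse_nil, List.nil_append, update_eq_self, this]
    exact Runs.weaken (Runs.loop_nil hx) (by simp)
  | cons a x ih =>
    refine Runs.weaken (t := (1 + 1) + (3 * x.length + 1) + 1) ?_ (by simp; omega)
    have hS : update (update (update S k x) k₁ (a :: update S k x k₁)) k₂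
      (a :: update (update S k x) k₁ (a :: update S k x k₁) k₂) k = x := by simp [h₁, h₂]
    convert! Runs.loop_cons (n := 1) (q := 0) (step := fun q _ => q)
      (body := fun _ a => seq (push k₁ a) (push k₂ a)) hx (Runs.seq (Runs.push k₁ a _) (Runs.push k₂ a _)) (ih _ hS) using 1
    funext r
    by_cases hr : r = k
    · subst hr; simp
    by_cases hr₂ : r = k₂
    · subst hr₂; simp [hr, h₁₂.symm]
    by_cases hr₁ : r = k₁
    · subst hr₁; simp [hr, hr₂]
    simp [hr, hr₁, hr₂]

end StackProg

/-! ### Word functions computed in polynomial time -/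

/-- The stacks of a program: variables, which hold arguments, and temporary stacks. -/
inductive Reg where
  | var (i : ℕ)
  | tmp (i : ℕ)
  deriving DecidableEq

open StackProg Function

/-- The function `f` of the words held by the variables, of which those from `k` on are empty, is
computed in polynomial time by a program that leaves the variables as they are, pushes its result
to the temporary stack `o`, and uses as work space the temporary stacks from `b` on. -/
def Impl (k : ℕ) (f : (ℕ → List Letter) → List Letter) : Prop :=
  ∀ b o, o < b → ∃ (p : StackProg Reg) (q : Polynomial ℕ), ∀ S : Reg → List Letter,
    (∀ i, k ≤ i → S (.var i) = []) → (∀ j, b ≤ j → S (.tmp j) = []) →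
    ∀ m, (∀ i, (S (.var i)).length ≤ m) →
      (f fun i => S (.var i)).length ≤ q.eval m ∧
      Runs p S (q.eval m) (update S (.tmp o) ((f fun i => S (.var i)).reverse ++ S (.tmp o)))

theorem StackProg.Runs.congr {p : StackProg Reg} {S S' S'' : Reg → List Letter} {t t' : ℕ}
    (h : Runs p S t S') (hS : ∀ r, S'' r = S' r) (ht : t ≤ t') : Runs p S t' S'' := by
  rw [show S'' = S' from funext hS]
  exact h.weaken ht

namespace Impl

variable {k : ℕ} {f g : (ℕ → List Letter) → List Letter}

/-- The result can also be put into an empty stack, in the right order. -/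
theorem toStack (hf : Impl k f) (b : ℕ) :
    ∃ (p : StackProg Reg) (q : Polynomial ℕ), ∀ S : Reg → List Letter,
      (∀ i, k ≤ i → S (.var i) = []) → (∀ j, b ≤ j → S (.tmp j) = []) →
      ∀ m, (∀ i, (S (.var i)).length ≤ m) →
        (f fun i => S (.var i)).length ≤ q.eval m ∧
        Runs p S (q.eval m) (update S (.tmp b) (f fun i => S (.var i))) := by
  -- The reversed result goes to `b + 1`; moving it to `b` reverses it again, and the work space
  -- starts above both.
  obtain ⟨p, q, h⟩ := hf (b + 2) (b + 1) (by omega)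
  refine ⟨seq p (move (.tmp (b + 1)) (.tmp b)), q + (7 * q + 1), fun S hv ht m hm => ?_⟩
  obtain ⟨h₁, h₂⟩ := h S hv (fun j hj => ht j (by omega)) m hm
  simp only [Polynomial.eval_add, Polynomial.eval_mul, Polynomial.eval_one,
    Polynomial.eval_ofNat]
  refine ⟨by omega, ?_⟩
  have h₃ := runs_move (k := Reg.tmp (b + 1)) (k' := .tmp b) (by simp) _ |> Runs.seq h₂
  refine Runs.congr (h₃) (fun r => ?_) ?_
  · rcases r with i | j
    · simp
    · by_cases hj : j = b + 1
      · subst hj; simp [ht]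
      by_cases hj' : j = b
      · subst hj'; simp [ht]
      simp [hj, hj']
  · simp [ht]
    omega

/-- Reading a stack destroys it. The variable is therefore emptied onto two stacks at once; one copy
is the reversed output, and moving the other back restores the variable in its original order. -/
theorem var (i : ℕ) : Impl k fun ρ => ρ i := by
  intro b o hb
  refine ⟨seq (moveTwo (.var i) (.tmp b) (.tmp o)) (move (.tmp b) (.var i)),
    10 * Polynomial.X + 2, fun S hv ht m hm => ?_⟩
  simp only [Polynomial.eval_add, Polynomial.eval_mul, Polynomial.eval_X,
    Polynomial.eval_ofNat]
  have := hm i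
  refine ⟨by omega, ?_⟩
  have h := Runs.seq (runs_moveTwo (k := Reg.var i) (k₁ := .tmp b) (k₂ := .tmp o) (by simp)
    (by simp) (by simp; omega) S) (runs_move (k := .tmp b) (k' := .var i) (by simp) _)
  have hob : o ≠ b := by omega
  refine Runs.congr (h) (fun r => ?_) ?_
  · rcases r with i' | j
    · by_cases hi : i' = i
      · subst hi; simp [ht, hob.symm]
      · simp [hi]
    · by_cases hj : j = b
      · subst hj; simp [ht, hob.symm]
      by_cases hj' : j = o
      · subst hj'; simp [hob]
      simp [hj, hj']
  · simp [ht, hob.symm]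
    omega

theorem lit (x : List Letter) : Impl k fun _ => x := by
  intro b o hb
  refine ⟨pushAll (.tmp o) x, (x.length + 1 : ℕ), fun S hv ht m hm => ?_⟩
  rw [Polynomial.eval_natCast]
  exact ⟨by simp, runs_pushAll _ _ _⟩

/-- Both results are pushed reversed onto the same stack, the second on top. The first program
leaves the work space empty, so the second can reuse it. -/
theorem append (hf : Impl k f) (hg : Impl k g) : Impl k fun ρ => f ρ ++ g ρ := by
  intro b o hb
  obtain ⟨p₁, q₁, h₁⟩ := hf b o hb
  obtain ⟨p₂, q₂, h₂⟩ := hg b o hb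
  refine ⟨seq p₁ p₂, q₁ + q₂, fun S hv ht m hm => ?_⟩
  obtain ⟨l₁, r₁⟩ := h₁ S hv ht m hm
  obtain ⟨l₂, r₂⟩ := h₂ (update S (.tmp o) ((f fun i => S (.var i)).reverse ++ S (.tmp o)))
    (by simpa using hv) (fun j hj => by simp [ht j hj, show j ≠ o by omega]) m (by simpa using hm)
  simp only [ne_eq, reduceCtorEq, not_false_eq_true, update_of_ne] at l₂ r₂
  rw [Polynomial.eval_add]
  refine ⟨by simp; omega, ?_⟩
  convert! Runs.seq r₁ r₂ using 1
  simp

theorem transduce (T : Transducer) (hf : Impl k f) : Impl k fun ρ => T.run (f ρ) := by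
  intro b o hb
  obtain ⟨p, q, h⟩ := hf.toStack b
  refine ⟨seq p (.transduce T T.start (.tmp b) (.tmp o)), q + ((T.bound + 2 : ℕ) * q + 1),
    fun S hv ht m hm => ?_⟩
  obtain ⟨l₁, r₁⟩ := h S hv ht m hm
  have hob : o ≠ b := by omega
  have r₂ := runs_transduce T T.start (k := Reg.tmp b) (k' := .tmp o) (by simp; omega) _
    |> Runs.seq r₁
  simp only [Polynomial.eval_add, Polynomial.eval_mul, Polynomial.eval_one,
    Polynomial.eval_natCast]
  have hl : (T.bound + 2) * (f fun i => S (.var i)).length ≤ (T.bound + 2) * q.eval m := by gcongr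
  refine ⟨?_, ?_⟩
  · have := T.length_runFrom_le T.start (f fun i => S (.var i))
    rw [Transducer.run]
    nlinarith
  refine Runs.congr (r₂) (fun r => ?_) ?_
  · rcases r with i | j
    · simp
    · by_cases hj : j = b
      · subst hj; simp [ht, hob.symm]
      by_cases hj' : j = o
      · subst hj'; simp [hob, Transducer.run]
      simp [hj, hj']
  · simp only [update_self, Nat.cast_id]
    omega

/-- A program that adds the length of the stack `b` to the binary number in the stack `b + 1`. -/
theorem runs_count (b : ℕ) : ∃ (p : StackProg Reg) (c : ℕ), ∀ (x : List Letter) (n : ℕ)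
    (S : Reg → List Letter), S (.tmp b) = x → S (.tmp (b + 1)) = encNat n → S (.tmp (b + 2)) = [] →
    Runs p S (c * (n + x.length + 1) * x.length + 1)
      (update (update S (.tmp (b + 1)) (encNat (n + x.length))) (.tmp b) []) := by
  let T := Transducer.increment
  let body : StackProg Reg := seq (.transduce T T.start (.tmp (b + 1)) (.tmp (b + 2)))
    (move (.tmp (b + 2)) (.tmp (b + 1)))
  -- One increment transduces the counter to an auxiliary stack, where it lies reversed, and moves
  -- it back; the cost is linear in the length of the counter.
  have hbody : ∀ (n : ℕ) (S : Reg → List Letter), S (.tmp (b + 1)) = encNat n →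
      S (.tmp (b + 2)) = [] → Runs body S ((T.bound + 11) * (n + 2))
        (update S (.tmp (b + 1)) (encNat (n + 1))) := by
    intro n S h₁ h₂
    have hT : T.runFrom T.start (encNat n) = encNat (n + 1) := Transducer.run_increment n
    have r := runs_transduce T T.start (k := Reg.tmp (b + 1)) (k' := .tmp (b + 2)) (by simp) S
    have r' := Runs.seq r (runs_move (k := Reg.tmp (b + 2)) (k' := .tmp (b + 1)) (by simp) _)
    refine Runs.congr (r') (fun r => ?_) ?_
    · rcases r with i | j
      · simp
      · by_cases hj : j = b + 2
        · subst hj; simp [h₂]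
        by_cases hj' : j = b + 1
        · subst hj'; simp [h₁, h₂, hT]
        simp [hj, hj']
    · have l₁ := length_encNat_le n
      have l₂ := length_encNat_le (n + 1)
      simp [h₁, h₂, hT]
      nlinarith
  refine ⟨loop (.tmp b) 1 0 (fun q _ => q) fun _ _ => body, T.bound + 12, fun x => ?_⟩
  induction x with
  | nil =>
    intro n S h₀ h₁ h₂
    have : update (update S (.tmp (b + 1)) (encNat (n + 0))) (.tmp b) [] = S := by
      rw [add_zero, ← h₁, update_eq_self, ← h₀, update_eq_self]
    simp only [List.length_nil, this]
    exact Runs.weaken (Runs.loop_nil h₀) (by simp)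
  | cons a x ih =>
    intro n S h₀ h₁ h₂
    have r₁ := hbody n (update S (.tmp b) x) (by simpa using h₁) (by simpa using h₂)
    have r₂ := ih (n + 1) _ (show update (update S (.tmp b) x) (.tmp (b + 1)) (encNat (n + 1))
      (.tmp b) = x by simp) (by simp) (by simpa using h₂)
    refine Runs.congr (Runs.loop_cons (n := 1) (q := 0) (step := fun q _ => q) (body := fun _ _ => body)
        h₀ r₁ r₂) (fun r => ?_) ?_
    · rcases r with i | j
      · simp
      · by_cases hj : j = b
        · subst hj; simp
        by_cases hj' : j = b + 1
        · subst hj'; simp; ring_nf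
        simp [hj, hj']
    · simp only [List.length_cons]
      nlinarith

/-- The counter starts as a single comma, the code of zero, and is incremented once for each letter
of the word. -/
theorem encNat_length (hf : Impl k f) : Impl k fun ρ => encNat (f ρ).length := by
  intro b o hb
  obtain ⟨p, q, h⟩ := hf.toStack b
  obtain ⟨p', c, h'⟩ := runs_count b
  refine ⟨seq p (seq (push (.tmp (b + 1)) .comma) (seq p' (move (.tmp (b + 1)) (.tmp o)))),
    q + (1 + (((c : ℕ) * (q + 1) * q + 1) + (7 * (q + 1) + 1))), fun S hv ht m hm => ?_⟩
  obtain ⟨l₁, r₁⟩ := h S hv ht m hm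
  beta_reduce
  generalize f (fun i => S (.var i)) = x at *
  have hl := length_encNat_le x.length
  simp only [Polynomial.eval_add, Polynomial.eval_mul, Polynomial.eval_one,
    Polynomial.eval_natCast, Polynomial.eval_ofNat]
  refine ⟨by omega, ?_⟩
  have hob : o ≠ b := by omega
  have hob' : o ≠ b + 1 := by omega
  have r₃ := h' x 0 (update (update S (.tmp b) x) (.tmp (b + 1))
    (.comma :: update S (.tmp b) x (.tmp (b + 1)))) (by simp) (by simp [ht]; rfl) (by simp [ht])
  have r := Runs.seq r₁ (Runs.seq (Runs.push (.tmp (b + 1)) .comma _) (Runs.seq r₃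
    (runs_move (k := Reg.tmp (b + 1)) (k' := .tmp o) (by simp; omega) _)))
  refine Runs.congr (r) (fun r => ?_) ?_
  · rcases r with i | j
    · simp
    · by_cases hj : j = b + 1
      · subst hj; simp [ht, hob'.symm]
      by_cases hj' : j = o
      · subst hj'; simp [hob, hob']
      by_cases hj'' : j = b
      · subst hj''; simp [ht, hob.symm]
      simp [hj, hj', hj'']
  · have : c * (x.length + 1) * x.length ≤ c * (q.eval m + 1) * q.eval m := by gcongr
    simp
    omega

variable {h₁ h₂ : (ℕ → List Letter) → List Letter}

/-- A program that empties the stacks `b` and `b + 1` and leaves the stack `b + 2` empty if and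
only if it was empty and the other two stacks were equal. -/
theorem runs_compare (b : ℕ) : ∃ p : StackProg Reg, ∀ (x y z : List Letter) (S : Reg → List Letter),
    S (.tmp b) = x → S (.tmp (b + 1)) = y → S (.tmp (b + 2)) = z →
    ∃ z', (z' = [] ↔ z = [] ∧ x = y) ∧ z'.length ≤ z.length + x.length + 1 ∧
    Runs p S (5 * x.length + 2 * y.length + 6)
      (update (update (update S (.tmp (b + 2)) z') (.tmp (b + 1)) []) (.tmp b) []) := by
  -- Both words are popped in parallel. A mismatch, including exhaustion of the second word, leaves
  -- a mark on `b + 2`; `rest` adds one if the second word is longer.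
  let body : Letter → StackProg Reg := fun a => popCase (.tmp (b + 1)) fun r =>
    if r = some a then skip else push (.tmp (b + 2)) .one
  let rest : StackProg Reg := popCase (.tmp (b + 1)) fun r =>
    if r = none then skip else seq (push (.tmp (b + 2)) .one) (clear (.tmp (b + 1)))
  refine ⟨seq (loop (.tmp b) 1 0 (fun q _ => q) fun _ a => body a) rest, fun x => ?_⟩
  -- The loop alone decides equality up to the unread part `y'` of the second word: the words agree
  -- exactly if no mark was added and `y'` is empty.
  suffices H : ∀ (y z : List Letter) (S : Reg → List Letter), S (.tmp b) = x →
      S (.tmp (b + 1)) = y → S (.tmp (b + 2)) = z → ∃ z' y', (z' = [] ∧ y' = [] ↔ z = [] ∧ x = y) ∧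
      z'.length ≤ z.length + x.length ∧ y'.length ≤ y.length ∧
      Runs (loop (.tmp b) 1 0 (fun q _ => q) fun _ a => body a) S (5 * x.length + 1)
        (update (update (update S (.tmp (b + 2)) z') (.tmp (b + 1)) y') (.tmp b) []) by
    intro y z S hx hy hz
    obtain ⟨z', y', hz', lz, ly, r⟩ := H y z S hx hy hz
    cases y' with
    | nil =>
      refine ⟨z', by simpa using hz', by omega, Runs.congr (Runs.seq r (Runs.popCase (t := 1)
        (S' := update (update (update S (.tmp (b + 2)) z') (.tmp (b + 1)) []) (.tmp b) []) ?_))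
        (fun _ => rfl) (by omega)⟩
      rw [if_pos (by simp)]
      refine Runs.congr (Runs.skip _) (fun r => ?_) le_rfl
      rcases r with i | j
      · simp
      · by_cases hj : j = b
        · subst hj; simp
        by_cases hj' : j = b + 1
        · subst hj'; simp
        simp [hj, hj']
    | cons a y' =>
      refine ⟨.one :: z', by simpa using hz', by simp; omega, Runs.congr (Runs.seq r
        (Runs.popCase (t := 1 + (2 * y'.length + 1)) (S' := update (update (update S (.tmp (b + 2))
          (.one :: z')) (.tmp (b + 1)) []) (.tmp b) []) ?_)) (fun _ => rfl)
        (by simp at ly; omega)⟩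
      have := Runs.seq (Runs.push (.tmp (b + 2)) .one (update (update (update (update S
        (.tmp (b + 2)) z') (.tmp (b + 1)) (a :: y')) (.tmp b) []) (.tmp (b + 1)) y'))
        (runs_clear (.tmp (b + 1)) _)
      refine Runs.congr (p := _) (S := _) (by simpa using this) (fun r => ?_) (by simp)
      rcases r with i | j
      · simp
      · by_cases hj : j = b
        · subst hj; simp
        by_cases hj' : j = b + 1
        · subst hj'; simp
        by_cases hj'' : j = b + 2
        · subst hj''; simp
        simp [hj, hj', hj'']
  induction x with
  | nil =>
    intro y z S hx hy hz
    refine ⟨z, y, by simp [eq_comm], by simp, le_rfl, ?_⟩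
    rw [← hz, update_eq_self, ← hy, update_eq_self, ← hx, update_eq_self]
    exact Runs.weaken (Runs.loop_nil hx) (by simp)
  | cons a x ih =>
    intro y z S hx hy hz
    have hb : Runs (body a) (update S (.tmp b) x) 2
        (update (update (update S (.tmp b) x) (.tmp (b + 1)) y.tail) (.tmp (b + 2))
          (if y.head? = some a then z else .one :: z)) := by
      refine Runs.popCase ?_
      have h₁ : update S (.tmp b) x (.tmp (b + 1)) = y := by simp [hy]
      rw [h₁]
      split_ifs with h
      · refine (Runs.skip _).congr (fun r => ?_) le_rfl
        by_cases hr : r = .tmp (b + 2)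
        · subst hr; simp [hz]
        · simp [hr]
      · refine (Runs.push _ _ _).congr (fun r => ?_) le_rfl
        by_cases hr : r = .tmp (b + 2)
        · subst hr; simp [hz]
        · simp [hr]
    obtain ⟨z', y', hz', lz, ly, r⟩ := ih y.tail (if y.head? = some a then z else .one :: z)
      (update (update (update S (.tmp b) x) (.tmp (b + 1)) y.tail) (.tmp (b + 2))
          (if y.head? = some a then z else .one :: z)) (by simp) (by simp) (by simp)
    refine ⟨z', y', ?_, ?_, ?_, Runs.congr (Runs.loop_cons (n := 1) (q := 0)
      (step := fun q _ => q) (body := fun _ a => body a) hx hb r) (fun r => ?_) ?_⟩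
    · rw [hz']
      rcases y with _ | ⟨c, y⟩
      · simp
      · by_cases hc : c = a
        · simp [hc]
        · simp [hc, Ne.symm hc]
    · refine lz.trans ?_
      split_ifs
      · simp
      · simp; omega
    · refine ly.trans ?_
      simp
    · rcases r with i | j
      · simp
      · by_cases hj : j = b
        · subst hj; simp
        by_cases hj' : j = b + 1
        · subst hj'; simp
        by_cases hj'' : j = b + 2
        · subst hj''; simp
        simp [hj, hj', hj'']
    · simp only [List.length_cons]
      omega

/-- After the comparison only the marks on `b + 2` remain. They are cleared before the negative
branch, so both branches start from the original stacks. -/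
theorem ite_eq (hf : Impl k f) (hg : Impl k g) (hh₁ : Impl k h₁) (hh₂ : Impl k h₂) :
    Impl k fun ρ => if f ρ = g ρ then h₁ ρ else h₂ ρ := by
  intro b o hb
  obtain ⟨p₁, q₁, H₁⟩ := hf.toStack b
  obtain ⟨p₂, q₂, H₂⟩ := hg.toStack (b + 1)
  obtain ⟨p₃, q₃, H₃⟩ := hh₁ b o hb
  obtain ⟨p₄, q₄, H₄⟩ := hh₂ b o hb
  obtain ⟨p, Hp⟩ := runs_compare b
  refine ⟨seq p₁ (seq p₂ (seq p (popCase (.tmp (b + 2)) fun r =>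
    if r = none then p₃ else seq (clear (.tmp (b + 2))) p₄))),
    q₁ + (q₂ + ((5 * q₁ + 2 * q₂ + 6) + (q₃ + q₄ + 2 * q₁ + 4))), fun S hv ht m hm => ?_⟩
  obtain ⟨l₁, r₁⟩ := H₁ S hv ht m hm
  obtain ⟨l₂, r₂⟩ := H₂ (update S (.tmp b) (f fun i => S (.var i))) (by simpa using hv)
    (fun j hj => by simp [ht j (by omega), show j ≠ b by omega]) m (by simpa using hm)
  obtain ⟨l₃, r₃⟩ := H₃ S hv ht m hm
  obtain ⟨l₄, r₄⟩ := H₄ S hv ht m hm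
  simp only [ne_eq, reduceCtorEq, not_false_eq_true, update_of_ne] at l₂ r₂
  simp only [Polynomial.eval_add, Polynomial.eval_mul, Polynomial.eval_ofNat]
  generalize f (fun i => S (.var i)) = x at *
  generalize g (fun i => S (.var i)) = y at *
  refine ⟨by split_ifs <;> omega, ?_⟩
  obtain ⟨z, hz, lz, r⟩ := Hp x y [] (update (update S (.tmp b) x) (.tmp (b + 1)) y)
    (by simp) (by simp) (by simp [ht])
  have hS : update (update (update (update (update S (.tmp b) x) (.tmp (b + 1)) y)
      (.tmp (b + 2)) z) (.tmp (b + 1)) []) (.tmp b) [] = update S (.tmp (b + 2)) z := by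
    funext r
    rcases r with i | j
    · simp
    · by_cases hj : j = b
      · subst hj; simp [ht]
      by_cases hj' : j = b + 1
      · subst hj'; simp [ht]
      simp [hj, hj', Function.update_apply]
  rw [hS] at r
  simp only [true_and] at hz
  simp only [List.length_nil, zero_add] at lz
  refine Runs.congr (t := q₁.eval m + (q₂.eval m + ((5 * x.length + 2 * y.length + 6) +
    ((q₃.eval m + q₄.eval m + 2 * z.length + 1) + 1))))
    (Runs.seq r₁ (Runs.seq r₂ (Runs.seq r (Runs.popCase ?_)))) (fun _ => rfl) (by omega)
  have hS' : update (update S (.tmp (b + 2)) z) (.tmp (b + 2)) [] = S := by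
    rw [update_idem, ← ht (b + 2) (by omega), update_eq_self]
  by_cases hxy : x = y
  · have hz := hz.2 hxy
    subst hz
    simp only [update_self, List.head?_nil, List.tail_nil, if_pos, hS', hxy]
    exact r₃.weaken (by simp; omega)
  · obtain ⟨a, z, rfl⟩ := List.exists_cons_of_ne_nil (fun h => hxy (hz.1 h))
    simp only [update_self, List.head?_cons, List.tail_cons, if_neg hxy, update_idem,
      reduceCtorEq, if_false]
    have rc := runs_clear (.tmp (b + 2)) (update S (.tmp (b + 2)) z)
    rw [update_idem, ← ht (b + 2) (by omega), update_eq_self, update_self] at rc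
    exact (Runs.seq rc r₄).weaken (by simp; omega)

/-- Letters accumulate on `b + 1` in reverse until a closing bracket arrives. The piece is then
moved to the fresh variable `k`, which restores its order, `g` is run, and the variable is cleared
for the next piece. -/
theorem forIn (hf : Impl k f) (hg : Impl (k + 1) g) :
    Impl k fun ρ => (chunks (f ρ)).flatMap fun c => g (update ρ k c) := by
  intro b o hb
  obtain ⟨p₁, q₁, H₁⟩ := hf.toStack b
  obtain ⟨p₂, q₂, H₂⟩ := hg (b + 2) o (by omega)
  let body : Letter → StackProg Reg := fun a =>
    if a = .rbr then seq (move (.tmp (b + 1)) (.var k)) (seq p₂ (clear (.var k)))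
    else push (.tmp (b + 1)) a
  let lp : StackProg Reg := loop (.tmp b) 1 0 (fun q _ => q) fun _ a => body a
  -- The invariant allows a partly read piece `acc`. Letters behind the last closing bracket belong
  -- to no piece; they remain as `acc'` and are cleared at the end. The cost per letter covers a
  -- move, a run of `g` and a clear.
  have hlp : ∀ (S : Reg → List Letter), (∀ i, k ≤ i → S (.var i) = []) →
      (∀ j, b ≤ j → S (.tmp j) = []) → ∀ m, (∀ i, (S (.var i)).length ≤ m) →
      ∀ x acc w : List Letter, acc.length + x.length ≤ m → ∃ acc' : List Letter,
        acc'.length ≤ acc.length + x.length ∧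
        ((chunksFrom acc x).flatMap fun c => g (update (fun i => S (.var i)) k c)).length ≤
          x.length * q₂.eval m ∧
        Runs lp (update (update (update S (.tmp b) x) (.tmp (b + 1)) acc.reverse) (.tmp o) w)
          (x.length * (9 * m + 4 + q₂.eval m) + 1)
          (update (update S (.tmp (b + 1)) acc') (.tmp o) (((chunksFrom acc x).flatMap fun c =>
            g (update (fun i => S (.var i)) k c)).reverse ++ w)) := by
    intro S hv ht m hm x
    have hob : o ≠ b := by omega
    have hob' : o ≠ b + 1 := by omega
    induction x with
    | nil =>
      intro acc w _
      refine ⟨acc.reverse, by simp, by simp [chunksFrom], Runs.congr (Runs.loop_nil ?_) (fun r => ?_)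
        (by simp)⟩
      · simp [hob.symm]
      · rcases r with i | j
        · simp
        · by_cases hj : j = o
          · subst hj; simp [chunksFrom]
          by_cases hj' : j = b + 1
          · subst hj'; simp [hj]
          by_cases hj'' : j = b
          · subst hj''; simp [hj, ht]
          simp [hj, hj', hj'']
    | cons a x ih =>
      intro acc w hl
      simp only [List.length_cons] at hl
      have hx : update (update (update S (.tmp b) (a :: x)) (.tmp (b + 1)) acc.reverse) (.tmp o) w
        (.tmp b) = a :: x := by simp [hob.symm]
      by_cases ha : a = .rbr
      · set v : List Letter := g (update (fun i => S (.var i)) k acc) with hv'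
        obtain ⟨acc', la, lg, r⟩ := ih [] (v.reverse ++ w) (by simp; omega)
        have r₁ := runs_move (k := Reg.tmp (b + 1)) (k' := .var k) (by simp)
          (update (update (update S (.tmp b) x) (.tmp (b + 1)) acc.reverse) (.tmp o) w)
        have hS : update (update (update (update (update S (.tmp b) x) (.tmp (b + 1)) acc.reverse)
            (.tmp o) w) (.var k) acc) (.tmp (b + 1)) [] =
            update (update (update S (.tmp b) x) (.tmp o) w) (.var k) acc := by
          funext r
          rcases r with i | j
          · simp [update_apply]
          · by_cases hj : j = b + 1
            · subst hj; simp [hob'.symm, ht]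
            simp [hj, update_apply]
        simp only [ne_eq, reduceCtorEq, not_false_eq_true, update_of_ne, update_self,
          Reg.tmp.injEq, hob'.symm, List.reverse_reverse, hv k le_rfl, List.append_nil,
          List.length_reverse, hS] at r₁
        obtain ⟨l₂, r₂⟩ := H₂ (update (update (update S (.tmp b) x) (.tmp o) w) (.var k) acc)
          (fun i hi => by simp [hv i (by omega), show i ≠ k by omega])
          (fun j hj => by simp [ht j (by omega), show j ≠ b by omega, show j ≠ o by omega]) m
          (fun i => by
            by_cases hi : i = k
            · subst hi; simp; omega
            · simpa [hi] using hm i)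
        have hρ : (fun i => update (update (update S (.tmp b) x) (.tmp o) w) (.var k) acc
            (.var i)) = update (fun i => S (.var i)) k acc := by
          funext i
          by_cases hi : i = k
          · subst hi; simp
          · simp [hi]
        rw [hρ, ← hv'] at l₂ r₂
        have r₃ := runs_clear (.var k) (update (update (update (update S (.tmp b) x) (.tmp o) w)
          (.var k) acc) (.tmp o) (v.reverse ++ update (update (update S (.tmp b) x) (.tmp o) w)
          (.var k) acc (.tmp o)))
        have hbody : Runs (body a) (update (update (update (update S (.tmp b) (a :: x))
            (.tmp (b + 1)) acc.reverse) (.tmp o) w) (.tmp b) x) (9 * m + 3 + q₂.eval m)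
            (update (update (update S (.tmp b) x) (.tmp (b + 1)) ([] : List Letter).reverse)
              (.tmp o) (v.reverse ++ w)) := by
          simp only [body, ha, if_true]
          have hS' : update (update (update (update S (.tmp b) (Letter.rbr :: x))
            (.tmp (b + 1)) acc.reverse) (.tmp o) w) (.tmp b) x =
            update (update (update S (.tmp b) x) (.tmp (b + 1)) acc.reverse) (.tmp o) w := by
            funext r
            by_cases hr : r = .tmp b
            · subst hr; simp [hob.symm]
            simp [hr, update_apply]
          rw [hS']
          refine Runs.congr (Runs.seq r₁ (Runs.seq r₂ r₃)) (fun r => ?_) (by simp; omega)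
          rcases r with i | j
          · by_cases hi : i = k
            · subst hi; simp [hv]
            · simp [hi]
          · by_cases hj : j = o
            · subst hj; simp
            by_cases hj' : j = b + 1
            · subst hj'; simp [hj, ht]
            simp [hj, hj']
        refine ⟨acc', by simp at la ⊢; omega, ?_, Runs.congr (Runs.loop_cons (n := 1) (q := 0)
          (step := fun q _ => q) (body := fun _ a => body a) hx hbody r) (fun r => ?_) ?_⟩
        · simp only [chunksFrom, ha, if_true, List.flatMap_cons, List.length_append,
            List.length_cons]
          linarith
        · simp [chunksFrom, ha, hv']
        · simp only [List.length_cons]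
          linarith
      · obtain ⟨acc', la, lg, r⟩ := ih (acc ++ [a]) w (by simp; omega)
        have hbody : Runs (body a) (update (update (update (update S (.tmp b) (a :: x))
            (.tmp (b + 1)) acc.reverse) (.tmp o) w) (.tmp b) x) (9 * m + 3 + q₂.eval m)
            (update (update (update S (.tmp b) x) (.tmp (b + 1)) (acc ++ [a]).reverse)
              (.tmp o) w) := by
          simp only [body, ha, if_false]
          refine Runs.congr (Runs.push _ _ _) (fun r => ?_) (by omega)
          rcases r with i | j
          · simp
          · by_cases hj : j = o
            · subst hj; simp [hob, hob']
            by_cases hj' : j = b + 1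
            · subst hj'; simp [hj]
            by_cases hj'' : j = b
            · subst hj''; simp [hj]
            simp [hj, hj', hj'']
        refine ⟨acc', by simp at la ⊢; omega, ?_, Runs.congr (Runs.loop_cons (n := 1) (q := 0)
          (step := fun q _ => q) (body := fun _ a => body a) hx hbody r) (fun r => ?_) ?_⟩
        · simp only [chunksFrom, ha, if_false, List.length_cons]
          linarith
        · simp [chunksFrom, ha]
        · simp only [List.length_cons]
          linarith
  refine ⟨seq p₁ (seq lp (clear (.tmp (b + 1)))),
    q₁ + ((q₁ * (9 * (.X + q₁) + 4 + q₂.comp (.X + q₁)) + 1) + (2 * q₁ + 1)),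
    fun S hv ht m hm => ?_⟩
  obtain ⟨l₁, r₁⟩ := H₁ S hv ht m hm
  beta_reduce
  generalize f (fun i => S (.var i)) = x at *
  -- During the loop the variables include a piece of `f ρ`, so `m + q₁.eval m` replaces `m` as the
  -- bound for their lengths.
  obtain ⟨acc', la, lg, r⟩ := hlp S hv ht (m + q₁.eval m)
    (fun i => (hm i).trans (Nat.le_add_right _ _)) x [] (S (.tmp o)) (by simp; omega)
  simp only [Polynomial.eval_add, Polynomial.eval_mul, Polynomial.eval_ofNat, Polynomial.eval_one,
    Polynomial.eval_X, Polynomial.eval_comp]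
  simp only [List.length_nil, zero_add] at la
  have hx : x.length * q₂.eval (m + q₁.eval m) ≤ q₁.eval m * q₂.eval (m + q₁.eval m) := by gcongr
  have hx' : x.length * (9 * (m + q₁.eval m) + 4 + q₂.eval (m + q₁.eval m)) ≤
    q₁.eval m * (9 * (m + q₁.eval m) + 4 + q₂.eval (m + q₁.eval m)) := by gcongr
  refine ⟨?_, ?_⟩
  · refine lg.trans (hx.trans ?_)
    rw [mul_add (q₁.eval m)]
    omega
  have hS : update (update (update S (.tmp b) x) (.tmp (b + 1)) ([] : List Letter).reverse)
      (.tmp o) (S (.tmp o)) = update S (.tmp b) x := by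
    funext r
    by_cases hr : r = .tmp o
    · subst hr; simp [show o ≠ b by omega]
    by_cases hr' : r = .tmp (b + 1)
    · subst hr'; simp [ht, hr]
    simp [hr, hr']
  rw [hS] at r
  refine Runs.congr (Runs.seq r₁ (Runs.seq r (runs_clear _ _))) (fun r => ?_) ?_
  · by_cases hr : r = .tmp (b + 1)
    · subst hr; simp [ht, show b + 1 ≠ o by omega]
    by_cases hr' : r = .tmp o
    · subst hr'; simp [hr, chunks]
    simp [hr, hr']
  · simp [show b + 1 ≠ o by omega]
    omega

/-- A word function of one argument that is implemented by a program is computable in polynomial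
time. -/
theorem polyTime {α β : Type} {encA : α → List Letter} {encB : β → List Letter} {F : α → β}
    (hf : Impl 1 f) (h : ∀ (a : α) (ρ : ℕ → List Letter), ρ 0 = encA a → f ρ = encB (F a)) :
    PolyTime encA encB F := by
  obtain ⟨p, q, H⟩ := hf.toStack 0
  refine StackProg.polyTime (seq p (clear (.var 0))) (.var 0) (.tmp 0)
    (q + (2 * Polynomial.X + 1)) fun a => ?_
  obtain ⟨-, r⟩ := H (update (fun _ => []) (.var 0) (encA a))
    (fun i hi => by simp [show i ≠ 0 by omega]) (fun j _ => by simp) (encA a).length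
    (fun i => by by_cases hi : i = 0 <;> simp [hi])
  rw [h a _ (by simp)] at r
  refine Runs.congr (Runs.seq r (runs_clear _ _)) (fun r => ?_) (by simp)
  by_cases hr : r = .var 0
  · subst hr; simp
  · simp [hr, update_apply]

end Impl

/-! ### Transducers for the codes of instances -/

/-- The comma makes the code of numbers prefix-free. Comparing concatenated codes as words therefore
compares the numbers, and nothing has to be decoded. -/
theorem encNat_append_inj {m n : ℕ} {x y : List Letter} :
    encNat m ++ x = encNat n ++ y ↔ m = n ∧ x = y := by
  refine ⟨fun h => ?_, by rintro ⟨rfl, rfl⟩; rfl⟩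
  have key : ∀ b c : List Bool, b.map Letter.ofBool ++ Letter.comma :: x =
      c.map Letter.ofBool ++ Letter.comma :: y → b = c ∧ x = y := by
    intro b
    induction b with
    | nil =>
      rintro (_ | ⟨_ | _, c⟩) h
      · simpa using h
      all_goals simp [Letter.ofBool] at h
    | cons a b ih =>
      rintro (_ | ⟨a', c⟩) h
      · cases a <;> simp [Letter.ofBool] at h
      · simp only [List.map_cons, List.cons_append, List.cons.injEq] at h
        obtain ⟨rfl, rfl⟩ := ih c h.2
        refine ⟨?_, rfl⟩
        cases a <;> cases a' <;> simp [Letter.ofBool] at h ⊢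
  obtain ⟨h₁, h₂⟩ := key m.bits n.bits (by simpa [encNat] using h)
  refine ⟨?_, h₂⟩
  have := congrArg (List.foldr (fun b n => Nat.bit b n) 0) h₁
  have hbits : ∀ n : ℕ, List.foldr (fun b n => Nat.bit b n) 0 n.bits = n := by
    intro n
    induction n using Nat.binaryRec' with
    | zero => rfl
    | bit b n h ih => rw [Nat.bits_append_bit n b h, List.foldr_cons, ih]
  rwa [hbits, hbits] at this

theorem encNat_inj {m n : ℕ} : encNat m = encNat n ↔ m = n := by
  simpa using encNat_append_inj (m := m) (n := n) (x := []) (y := [])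

theorem ne_bracket_of_mem_encNat {n : ℕ} {a : Letter} (h : a ∈ encNat n) :
    a ≠ .lbr ∧ a ≠ .rbr := by
  simp only [encNat, List.mem_append, List.mem_map, List.mem_singleton] at h
  rcases h with ⟨b, -, rfl⟩ | rfl
  · cases b <;> simp [Letter.ofBool]
  · simp

theorem flatMap_encNat_of_digits {n : ℕ} {f : Letter → List Letter} (h₀ : f .zero = [.zero])
    (h₁ : f .one = [.one]) :
    (encNat n).flatMap f = (n.bits.map Letter.ofBool) ++ f .comma := by
  have : (n.bits.map Letter.ofBool).flatMap f = n.bits.map Letter.ofBool := by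
    induction n.bits with
    | nil => rfl
    | cons b l ih =>
      rw [List.map_cons, List.flatMap_cons, ih]
      cases b
      · rw [Letter.ofBool, h₀]; rfl
      · rw [Letter.ofBool, h₁]; rfl
  simp [encNat, List.flatMap_append, this]

/-- The code of a station with its domain. -/
def encStationPair (s : ℕ × List ℕ) : List Letter :=
  encNat s.1 ++ encList encNat s.2

/-- The code of an interference constraint. -/
abbrev encConstraint : (ℕ × ℕ) × (ℕ × ℕ) → List Letter :=
  encPair (encPair encNat encNat) (encPair encNat encNat)

namespace Transducer

theorem runFrom_append_of_fixed (T : Transducer) (q : Fin T.n) (x y : List Letter)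
    (h : ∀ a ∈ x, T.step q a = q) : T.runFrom q (x ++ y) = x.flatMap (T.out q) ++ T.runFrom q y := by
  induction x with
  | nil => rfl
  | cons a x ih =>
    simp only [List.mem_cons, forall_eq_or_imp] at h
    simp [runFrom, h.1, ih h.2]

/-- The transducer that ignores everything up to the first letter `sep` and replaces each letter
behind it by a word. -/
def after (sep : Letter) (f : Letter → List Letter) : Transducer where
  n := 2
  start := 0
  step q a := if q = 1 ∨ a = sep then 1 else 0
  out q a := if q = 1 then f a else []

/-- Only the first `sep` triggers the switch, so `y` may contain further ones. -/
theorem run_after {sep : Letter} {f : Letter → List Letter} {x y : List Letter} (hx : sep ∉ x) :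
    (after sep f).run (x ++ sep :: y) = y.flatMap f := by
  have h₁ : (after sep f).runFrom (1 : Fin 2) y = y.flatMap f := by
    have := (after sep f).runFrom_append_of_fixed (1 : Fin 2) y [] (by simp [after])
    simpa [after, runFrom] using this
  rw [run, runFrom_append_of_fixed]
  · have h0 : ∀ a, (after sep f).out (after sep f).start a = [] := by simp [after]
    have h1 : (after sep f).step (after sep f).start sep = (1 : Fin 2) := by simp [after]
    have : x.flatMap ((after sep f).out (after sep f).start) = [] := by simp [h0]
    rw [this, runFrom, h0, h1, h₁]
    rfl
  · intro a ha
    have : a ≠ sep := fun h => hx (h ▸ ha)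
    simp [after, this]

/-- The transducer that copies everything up to the first opening bracket. -/
def beforeLbr : Transducer where
  n := 2
  start := 0
  step q a := if q = 1 ∨ a = .lbr then 1 else 0
  out q a := if q = 1 ∨ a = .lbr then [] else [a]

theorem run_beforeLbr {x y : List Letter} (hx : Letter.lbr ∉ x) :
    beforeLbr.run (x ++ Letter.lbr :: y) = x := by
  have h₁ : beforeLbr.runFrom (1 : Fin 2) y = [] := by
    have := beforeLbr.runFrom_append_of_fixed (1 : Fin 2) y [] (by simp [beforeLbr])
    rw [List.append_nil] at this
    exact this.trans (by simp [beforeLbr, runFrom, List.flatMap_eq_nil_iff])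
  rw [run, runFrom_append_of_fixed]
  · have : ∀ z : List Letter, Letter.lbr ∉ z → z.flatMap (beforeLbr.out beforeLbr.start) = z := by
      intro z hz
      induction z with
      | nil => rfl
      | cons a z ih =>
        simp only [List.mem_cons, not_or] at hz
        rw [List.flatMap_cons, ih hz.2]
        simp [beforeLbr, Ne.symm hz.1]
    rw [this x hx]
    have h1 : beforeLbr.step beforeLbr.start .lbr = (1 : Fin 2) := by simp [beforeLbr]
    have h0 : beforeLbr.out beforeLbr.start .lbr = [] := by simp [beforeLbr]
    rw [runFrom, h0, h1, h₁]
    simp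
  · intro a ha
    have : a ≠ .lbr := fun h => hx (h ▸ ha)
    simp [beforeLbr, this]

/-- A transducer that recognizes the end of the list of stations with their domains: its states
are `0` before this list, `1` in the list but outside domains, `2` in a domain, and `3` behind the
list. -/
def stationScan (f : Fin 4 → Letter → List Letter) : Transducer where
  n := 4
  start := 0
  step q a :=
    if q = 0 then 1
    else if q = 1 then (if a = .rbr then 3 else if a = .lbr then 2 else 1)
    else if q = 2 then (if a = .rbr then 1 else 2)
    else 3
  out := f

/-- The brackets are nested to depth two only, so finitely many states can match them. Leaving `f`
arbitrary lets one scan serve both to extract the stations and to skip them. -/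
theorem run_stationScan (f : Fin 4 → Letter → List Letter) (l : List (ℕ × List ℕ))
    (y : List Letter) :
    (stationScan f).run (encList encStationPair l ++ y) =
      f 0 .lbr ++ (l.flatMap fun s => (encNat s.1).flatMap (f 1) ++ f 1 .lbr ++
        (s.2.flatMap encNat).flatMap (f 2) ++ f 2 .rbr) ++ f 1 .rbr ++ y.flatMap (f 3) := by
  have h₃ : (stationScan f).runFrom (3 : Fin 4) y = y.flatMap (f 3) := by
    have := (stationScan f).runFrom_append_of_fixed (3 : Fin 4) y [] (by simp [stationScan])
    simpa [stationScan, runFrom] using this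
  have h₂ : ∀ (l : List ℕ) z, (stationScan f).runFrom (2 : Fin 4) (l.flatMap encNat ++ .rbr :: z) =
      (l.flatMap encNat).flatMap (f 2) ++ f 2 .rbr ++ (stationScan f).runFrom (1 : Fin 4) z := by
    intro l z
    refine (runFrom_append_of_fixed (stationScan f) (2 : Fin 4) _ _ ?_).trans ?_
    · intro a ha
      simp only [List.mem_flatMap] at ha
      obtain ⟨n, -, hn⟩ := ha
      simp [stationScan, (ne_bracket_of_mem_encNat hn).2]
    · simp [runFrom, stationScan]
  have h₁ : ∀ l : List (ℕ × List ℕ), (stationScan f).runFrom (1 : Fin 4)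
      (l.flatMap encStationPair ++ .rbr :: y) =
      (l.flatMap fun s => (encNat s.1).flatMap (f 1) ++ f 1 .lbr ++
        (s.2.flatMap encNat).flatMap (f 2) ++ f 2 .rbr) ++ f 1 .rbr ++ y.flatMap (f 3) := by
    intro l
    induction l with
    | nil =>
      have : (stationScan f).step (1 : Fin 4) .rbr = (3 : Fin 4) := by simp [stationScan]
      change f 1 .rbr ++ (stationScan f).runFrom ((stationScan f).step (1 : Fin 4) .rbr) y = _
      rw [this, h₃]
      simp
    | cons s l ih =>
      have hs : ∀ z, (stationScan f).runFrom (1 : Fin 4) (encNat s.1 ++ z) =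
          (encNat s.1).flatMap (f 1) ++ (stationScan f).runFrom (1 : Fin 4) z := by
        intro z
        refine runFrom_append_of_fixed _ _ _ _ fun a ha => ?_
        simp [stationScan, ne_bracket_of_mem_encNat ha]
      have hl : ∀ z, (stationScan f).runFrom (1 : Fin 4) (.lbr :: z) =
          f 1 .lbr ++ (stationScan f).runFrom (2 : Fin 4) z := fun z => rfl
      simp only [List.flatMap_cons, encStationPair, encList, List.append_assoc, List.cons_append,
        List.nil_append, hs, hl, h₂]
      simp only [List.append_assoc] at ih
      rw [ih]
  have h₀ : ∀ z, (stationScan f).run (.lbr :: z) =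
      f 0 .lbr ++ (stationScan f).runFrom (1 : Fin 4) z := fun z => rfl
  simp only [encList, List.cons_append, h₀, List.append_assoc, h₁,
    List.nil_append]

/-- The transducer that removes brackets and writes a closing bracket behind every fourth
number. -/
def groupFour : Transducer where
  n := 4
  start := 0
  step q a := if a = .comma then q + 1 else q
  out q a :=
    if a = .lbr ∨ a = .rbr then [] else if a = .comma ∧ q = 3 then [.comma, .rbr] else [a]

/-- The state counts commas modulo four, the number of entries of a constraint; addition in `Fin 4`
wraps around after each complete constraint. -/
theorem runFrom_groupFour_encNat (q : Fin 4) (n : ℕ) (y : List Letter) :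
    groupFour.runFrom q (encNat n ++ y) =
      encNat n ++ (if q = 3 then [.rbr] else []) ++ groupFour.runFrom (q + 1 : Fin 4) y := by
  have : ∀ l : List Bool, groupFour.runFrom q (l.map Letter.ofBool ++ .comma :: y) =
      l.map Letter.ofBool ++ (.comma :: if q = 3 then [.rbr] else []) ++
        groupFour.runFrom (q + 1 : Fin 4) y := by
    intro l
    induction l with
    | nil =>
      change groupFour.out q .comma ++ groupFour.runFrom (q + 1 : Fin 4) y = _
      by_cases hq : q = 3 <;> simp [groupFour, hq]
    | cons b l ih =>
      have h0 : groupFour.out q (Letter.ofBool b) = [Letter.ofBool b] := by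
        cases b <;> simp [groupFour, Letter.ofBool]
      have h1 : groupFour.step q (Letter.ofBool b) = q := by
        cases b <;> simp [groupFour, Letter.ofBool]
      rw [List.map_cons, List.cons_append]
      change groupFour.out q _ ++ groupFour.runFrom (groupFour.step q _) _ = _
      rw [h0, h1, ih]
      simp
  simpa [encNat] using this n.bits

theorem run_groupFour (l : List ((ℕ × ℕ) × (ℕ × ℕ))) :
    groupFour.run (encList encConstraint l) = l.flatMap fun i => encConstraint i ++ [.rbr] := by
  have : groupFour.runFrom (0 : Fin 4) (l.flatMap encConstraint ++ [.rbr]) =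
      l.flatMap fun i => encConstraint i ++ [.rbr] := by
    induction l with
    | nil => rfl
    | cons i l ih =>
      simp only [List.flatMap_cons, encConstraint, encPair, List.append_assoc] at ih ⊢
      rw [runFrom_groupFour_encNat, runFrom_groupFour_encNat, runFrom_groupFour_encNat,
        runFrom_groupFour_encNat]
      simp [← ih]
  exact this

end Transducer

/-! ### The constraint graph on words -/

namespace ConstraintWord

open Transducer

/-- The stations with their domains, each ended by a closing bracket. -/
def stations (w : List Letter) : List Letter :=
  (stationScan fun q a => if q = 2 ∨ (q = 1 ∧ a ≠ .rbr) then [a] else []).run w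

/-- What follows the list of stations. -/
def rest (w : List Letter) : List Letter :=
  (stationScan fun q a => if q = 3 then [a] else []).run w

/-- The name of a station, from the piece that describes the station and its domain. -/
def name (c : List Letter) : List Letter :=
  beforeLbr.run c

/-- The channels of a station, from the piece that describes the station and its domain, each
ended by a closing bracket. -/
def domain (c : List Letter) : List Letter :=
  (after .lbr fun a => if a = .comma then [.comma, .rbr] else [a]).run c

/-- The concatenation of the words `f c` where `c` ranges over the pieces of `x`. -/
def forChunks (x : List Letter) (f : List Letter → List Letter) : List Letter :=
  (chunks x).flatMap f

/-- A word that is empty if and only if neither `x` nor `y` is an interference constraint. -/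
def search (w x y : List Letter) : List Letter :=
  forChunks (groupFour.run (rest w)) fun c =>
    if c = x then [.one] else if c = y then [.one] else []

/-- The entry of the adjacency matrix for two vertices, each given by the piece that describes the
station and the channel. -/
def entry (w c₁ d₁ c₂ d₂ : List Letter) : List Letter :=
  if name c₁ = name c₂ then (if d₁ = d₂ then [.zero] else [.one])
  else if search w (name c₁ ++ d₁ ++ (name c₂ ++ d₂)) (name c₂ ++ d₂ ++ (name c₁ ++ d₁)) = []
    then [.zero] else [.one]

/-- The adjacency matrix of the constraint graph. -/
def matrix (w : List Letter) : List Letter :=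
  [.lbr] ++ (forChunks (stations w) fun c₁ => forChunks (domain c₁) fun d₁ =>
    [.lbr] ++ (forChunks (stations w) fun c₂ => forChunks (domain c₂) fun d₂ =>
      entry w c₁ d₁ c₂ d₂) ++ [.rbr]) ++ [.rbr]

/-- One letter for every station. -/
def unaryCard (w : List Letter) : List Letter :=
  (ofLetters fun a => if a = .rbr then [.one] else []).run (stations w)

/-- The hypothesis `h` says that the body depends on variable `k` only through the piece passed to
it, so storing the piece there is harmless. -/
theorem impl_forChunks {k : ℕ} {f : (ℕ → List Letter) → List Letter}
    {g : (ℕ → List Letter) → List Letter → List Letter} (hf : Impl k f)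
    (hg : Impl (k + 1) fun ρ => g ρ (ρ k))
    (h : ∀ ρ c, g (Function.update ρ k c) c = g ρ c) :
    Impl k fun ρ => forChunks (f ρ) (g ρ) := by
  convert Impl.forIn hf hg using 2 with ρ
  simp [forChunks, h]

theorem impl_unaryCard (k : ℕ) : Impl k fun ρ => unaryCard (ρ 0) :=
  ((Impl.var 0).transduce _).transduce _

theorem impl_search : Impl 5 fun ρ => search (ρ 0) (name (ρ 1) ++ ρ 2 ++ (name (ρ 3) ++ ρ 4))
    (name (ρ 3) ++ ρ 4 ++ (name (ρ 1) ++ ρ 2)) := by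
  have hn : ∀ i, Impl 6 fun ρ => name (ρ i) := fun i => (Impl.var i).transduce _
  have hv : ∀ i, Impl 6 fun ρ => ρ i := Impl.var
  refine impl_forChunks (g := fun ρ c => if c = _ then _ else if c = _ then _ else _)
    (((Impl.var 0).transduce _).transduce _) ?_ ?_
  · exact Impl.ite_eq (hv 5) (((hn 1).append (hv 2)).append ((hn 3).append (hv 4))) (Impl.lit _)
      (Impl.ite_eq (hv 5) (((hn 3).append (hv 4)).append ((hn 1).append (hv 2))) (Impl.lit _)
        (Impl.lit _))
  · intro ρ c
    simp

theorem impl_entry : Impl 5 fun ρ => entry (ρ 0) (ρ 1) (ρ 2) (ρ 3) (ρ 4) := by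
  have hn : ∀ i, Impl 5 fun ρ => name (ρ i) := fun i => (Impl.var i).transduce _
  exact Impl.ite_eq (hn 1) (hn 3)
    (Impl.ite_eq (Impl.var 2) (Impl.var 4) (Impl.lit _) (Impl.lit _))
    (Impl.ite_eq impl_search (Impl.lit []) (Impl.lit _) (Impl.lit _))

/-- Variable `0` holds the input and variables `1` to `4` hold the pieces of the four nested loops;
the search inside uses variable `5`. -/
theorem impl_matrix : Impl 1 fun ρ => matrix (ρ 0) := by
  have hs : ∀ k, Impl k fun ρ => stations (ρ 0) := fun k => (Impl.var 0).transduce _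
  have hd : ∀ k i, Impl k fun ρ => domain (ρ i) := fun k i => (Impl.var i).transduce _
  refine ((Impl.lit _).append (impl_forChunks (g := fun ρ c₁ => forChunks (domain c₁) fun d₁ =>
    [.lbr] ++ (forChunks (stations (ρ 0)) fun c₂ => forChunks (domain c₂) fun d₂ =>
      entry (ρ 0) c₁ d₁ c₂ d₂) ++ [.rbr]) (hs 1) ?_ ?_)).append (Impl.lit _)
  · refine impl_forChunks (g := fun ρ d₁ => [.lbr] ++ (forChunks (stations (ρ 0)) fun c₂ =>
      forChunks (domain c₂) fun d₂ => entry (ρ 0) (ρ 1) d₁ c₂ d₂) ++ [.rbr]) (hd 2 1) ?_ ?_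
    · refine ((Impl.lit _).append (impl_forChunks (g := fun ρ c₂ => forChunks (domain c₂) fun d₂ =>
        entry (ρ 0) (ρ 1) (ρ 2) c₂ d₂) (hs 3) ?_ ?_)).append (Impl.lit _)
      · refine impl_forChunks (g := fun ρ d₂ => entry (ρ 0) (ρ 1) (ρ 2) (ρ 3) d₂) (hd 4 3)
          impl_entry ?_
        intro ρ c
        simp
      · intro ρ c
        simp
    · intro ρ c
      simp
  · intro ρ c
    simp

end ConstraintWord

namespace BRP

open Transducer

/-- The list of the stations with their domains. -/
def stationList (P : BRP) : List (ℕ × List ℕ) :=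
  (P.stations.sort (· ≤ ·)).map fun s => (s, (P.dom s).sort (· ≤ ·))

/-- The list of the vertices of the constraint graph. -/
def vertexList (P : BRP) : List (ℕ × ℕ) :=
  P.stationList.flatMap fun s => s.2.map fun c => (s.1, c)

theorem mem_vertexList {P : BRP} {v : ℕ × ℕ} :
    v ∈ P.vertexList ↔ v.1 ∈ P.stations ∧ v.2 ∈ P.dom v.1 := by
  simp only [vertexList, stationList, List.mem_flatMap, List.mem_map, Finset.mem_sort]
  constructor
  · rintro ⟨_, ⟨s, hs, rfl⟩, c, hc, rfl⟩
    exact ⟨hs, by simpa using hc⟩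
  · rintro ⟨h₁, h₂⟩
    exact ⟨_, ⟨v.1, h₁, rfl⟩, v.2, by simpa using h₂, rfl⟩

theorem mem_vertices {P : BRP} {v : ℕ × ℕ} :
    v ∈ P.vertices ↔ v.1 ∈ P.stations ∧ v.2 ∈ P.dom v.1 := by
  simp only [vertices, channels, Finset.mem_filter, Finset.mem_product, Finset.mem_biUnion]
  exact ⟨fun h => ⟨h.1.1, h.2⟩, fun h => ⟨⟨h.1, v.1, h.1, h.2⟩, h.2⟩⟩

theorem nodup_vertexList (P : BRP) : P.vertexList.Nodup := by
  rw [vertexList, stationList, List.flatMap_map, List.nodup_flatMap]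
  refine ⟨fun s _ => (Finset.sort_nodup _ _).map fun a b h => (Prod.ext_iff.1 h).2,
    (Finset.sort_nodup P.stations (· ≤ ·)).imp fun {s t} hst => ?_⟩
  simp only [Function.onFun, List.disjoint_left, List.mem_map]
  rintro _ ⟨c, -, rfl⟩ ⟨d, -, h⟩
  exact hst (Prod.ext_iff.1 h).1.symm

/-- The numbering of the vertices of the constraint graph. -/
def vertexEquiv (P : BRP) : Fin P.vertexList.length ≃ P.vertices :=
  (P.nodup_vertexList.getEquiv _).trans
    (Equiv.subtypeEquivRight fun _ => mem_vertexList.trans mem_vertices.symm)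

/-- The constraint graph with numbered vertices. -/
def toFinGraph (P : BRP) : FinGraph where
  order := P.vertexList.length
  graph := P.constraintGraph.comap P.vertexEquiv

/-- The numbering of the vertices is an isomorphism. -/
def toFinGraphIso (P : BRP) : P.toFinGraph.graph ≃g P.constraintGraph :=
  SimpleGraph.Iso.comap P.vertexEquiv P.constraintGraph

theorem encode_eq (P : BRP) :
    P.encode = encList encStationPair P.stationList ++ encList encConstraint P.interferenceList := by
  simp only [encode, stationList, encList, List.flatMap_map]
  rfl

theorem mem_interferenceList {P : BRP} {i : (ℕ × ℕ) × (ℕ × ℕ)} :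
    i ∈ P.interferenceList ↔ i ∈ P.interference := by
  simp only [interferenceList, List.mem_map, Finset.mem_sort, Finset.mem_image]
  constructor
  · rintro ⟨_, ⟨j, hj, rfl⟩, rfl⟩
    exact hj
  · exact fun hi => ⟨_, ⟨i, hi, rfl⟩, rfl⟩

/-- The suffix `y` makes this usable for the answer maps, whose input is the instance followed by an
answer. -/
theorem stations_encode (P : BRP) (y : List Letter) : ConstraintWord.stations (P.encode ++ y) =
    P.stationList.flatMap fun s => encNat s.1 ++ .lbr :: s.2.flatMap encNat ++ [.rbr] := by
  rw [ConstraintWord.stations, encode_eq, List.append_assoc, run_stationScan]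
  have h : ∀ s : ℕ × List ℕ, (encNat s.1).flatMap (fun a => if a = .rbr then [] else [a]) =
      encNat s.1 := by
    intro s
    rw [flatMap_encNat_of_digits (by simp) (by simp)]
    rfl
  have h₁ : (fun a : Letter => if (1 : Fin 4) = 2 ∨ ((1 : Fin 4) = 1 ∧ a ≠ .rbr) then [a] else []) =
      fun a => if a = .rbr then [] else [a] := by
    funext a
    by_cases ha : a = .rbr <;> simp [ha]
  have h₃ : ∀ z : List Letter, z.flatMap (fun a : Letter => if (3 : Fin 4) = 2 ∨ ((3 : Fin 4) = 1 ∧ a ≠ .rbr) then [a]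
      else []) = [] :=
    fun z => List.flatMap_eq_nil_iff.2 fun a _ => by simp
  rw [h₁, h₃]
  simp [h]

theorem chunks_stations_encode (P : BRP) (y : List Letter) :
    chunks (ConstraintWord.stations (P.encode ++ y)) =
      P.stationList.map fun s => encNat s.1 ++ .lbr :: s.2.flatMap encNat := by
  have h := chunks_flatMap P.stationList (fun s => encNat s.1 ++ .lbr :: s.2.flatMap encNat)
  rw [stations_encode, h]
  intro s _
  simp only [List.mem_append, List.mem_cons, List.mem_flatMap, reduceCtorEq, false_or, not_or,
    not_exists, not_and]
  exact ⟨fun h => (ne_bracket_of_mem_encNat h).2 rfl,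
    fun n _ h => (ne_bracket_of_mem_encNat h).2 rfl⟩

theorem rest_encode (P : BRP) (y : List Letter) :
    ConstraintWord.rest (P.encode ++ y) = encList encConstraint P.interferenceList ++ y := by
  rw [ConstraintWord.rest, encode_eq, List.append_assoc, run_stationScan]
  simp [List.flatMap_eq_nil_iff]

theorem rbr_notMem_encConstraint (i : (ℕ × ℕ) × (ℕ × ℕ)) : Letter.rbr ∉ encConstraint i := by
  simp only [encConstraint, encPair, List.mem_append, not_or]
  refine ⟨⟨?_, ?_⟩, ?_, ?_⟩ <;> exact fun h => (ne_bracket_of_mem_encNat h).2 rfl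

theorem name_piece (s : ℕ) (y : List Letter) :
    ConstraintWord.name (encNat s ++ .lbr :: y) = encNat s :=
  run_beforeLbr fun h => (ne_bracket_of_mem_encNat h).1 rfl

theorem chunks_domain_piece (s : ℕ) (l : List ℕ) :
    chunks (ConstraintWord.domain (encNat s ++ .lbr :: l.flatMap encNat)) = l.map encNat := by
  rw [ConstraintWord.domain, run_after fun h => (ne_bracket_of_mem_encNat h).1 rfl,
    List.flatMap_assoc]
  rw [← chunks_flatMap l encNat fun n _ h => (ne_bracket_of_mem_encNat h).2 rfl]
  congr 2
  funext n
  rw [flatMap_encNat_of_digits (by simp) (by simp)]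
  simp [encNat]

theorem search_eq_nil_iff (P : BRP) (i j : (ℕ × ℕ) × (ℕ × ℕ)) :
    ConstraintWord.search P.encode (encConstraint i) (encConstraint j) = [] ↔
      i ∉ P.interference ∧ j ∉ P.interference := by
  have hinj : ∀ i j, encConstraint i = encConstraint j ↔ i = j := by
    rintro ⟨⟨a, b⟩, c, d⟩ ⟨⟨a', b'⟩, c', d'⟩
    simp [encConstraint, encPair, encNat_append_inj, encNat_inj, and_assoc]
  have hr : ConstraintWord.rest P.encode = encList encConstraint P.interferenceList := by
    simpa using rest_encode P []
  rw [ConstraintWord.search, ConstraintWord.forChunks, hr, run_groupFour,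
    chunks_flatMap _ _ fun i _ => rbr_notMem_encConstraint i, List.flatMap_map,
    List.flatMap_eq_nil_iff]
  simp only [hinj, mem_interferenceList]
  constructor
  · intro h
    exact ⟨fun hi => by simpa using h i hi, fun hj => by simpa using h j hj⟩
  · rintro ⟨hi, hj⟩ k hk
    rw [if_neg (by rintro rfl; exact hi hk), if_neg (by rintro rfl; exact hj hk)]

-- For vertices of the same station, `P.ne` excludes interference, so the channels alone decide
-- adjacency; for different stations only the search for an interference constraint matters.
open Classical in
theorem entry_encode (P : BRP) (v w : P.vertices) (x y : List Letter) :
    ConstraintWord.entry P.encode (encNat v.1.1 ++ .lbr :: x) (encNat v.1.2)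
      (encNat w.1.1 ++ .lbr :: y) (encNat w.1.2) =
      encBool (decide (P.constraintGraph.Adj v w)) := by
  have hs := search_eq_nil_iff P (v, w) (w, v)
  simp only [encConstraint, encPair] at hs
  simp only [ConstraintWord.entry, name_piece, encNat_inj, hs]
  have h₁ := P.ne ((v : ℕ × ℕ), (w : ℕ × ℕ))
  have h₂ := P.ne ((w : ℕ × ℕ), (v : ℕ × ℕ))
  by_cases hvw : v.1.1 = w.1.1
  · have h₁' := fun h => h₁ h hvw
    have h₂' := fun h => h₂ h hvw.symm
    by_cases hc : v.1.2 = w.1.2 <;>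
    simp [constraintGraph, hvw, hc, eq_false h₁', eq_false h₂', encBool, Letter.ofBool]
  · by_cases h₁ : ((v : ℕ × ℕ), (w : ℕ × ℕ)) ∈ P.interference <;>
    by_cases h₂ : ((w : ℕ × ℕ), (v : ℕ × ℕ)) ∈ P.interference <;>
    simp [constraintGraph, hvw, h₁, h₂, encBool, Letter.ofBool]

/-- The loops over stations and their channels visit the vertices in the order of `vertexList`,
which is the order that defines `vertexEquiv`; rows and columns therefore match. -/
theorem matrix_encode (P : BRP) : ConstraintWord.matrix P.encode = P.toFinGraph.encode := by
  have hs := chunks_stations_encode P []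
  rw [List.append_nil] at hs
  have hV : ∀ g : List Letter → List Letter → List Letter,
      (ConstraintWord.forChunks (ConstraintWord.stations P.encode) fun c =>
        ConstraintWord.forChunks (ConstraintWord.domain c) (g c)) =
      P.stationList.flatMap fun s => s.2.flatMap fun c =>
        g (encNat s.1 ++ .lbr :: s.2.flatMap encNat) (encNat c) := by
    intro g
    simp only [ConstraintWord.forChunks, hs, List.flatMap_map, chunks_domain_piece]
  have hd : ∀ s ∈ P.stationList, s.2 = (P.dom s.1).sort (· ≤ ·) := by
    simp [stationList]
  have hV' : ∀ g : List Letter → List Letter → List Letter,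
      (ConstraintWord.forChunks (ConstraintWord.stations P.encode) fun c =>
        ConstraintWord.forChunks (ConstraintWord.domain c) (g c)) =
      (List.finRange P.vertexList.length).flatMap fun i =>
        g (encNat (P.vertexEquiv i).1.1 ++
          .lbr :: ((P.dom (P.vertexEquiv i).1.1).sort (· ≤ ·)).flatMap encNat)
          (encNat (P.vertexEquiv i).1.2) := by
    intro g
    have : ∀ h : ℕ × ℕ → List Letter, (List.finRange P.vertexList.length).flatMap
        (fun i => h (P.vertexEquiv i)) = P.vertexList.flatMap h := by
      intro h
      conv_rhs => rw [← List.map_get_finRange P.vertexList, List.flatMap_map]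
      rfl
    rw [hV, this fun v => g (encNat v.1 ++ .lbr :: ((P.dom v.1).sort (· ≤ ·)).flatMap encNat)
      (encNat v.2), vertexList, List.flatMap_assoc]
    refine List.flatMap_congr fun s hs => ?_
    rw [List.flatMap_map, hd s hs]
  simp only [ConstraintWord.matrix, hV', entry_encode]
  simp [FinGraph.encode, encList, toFinGraph]
  rfl

theorem length_unaryCard (P : BRP) (y : List Letter) :
    (ConstraintWord.unaryCard (P.encode ++ y)).length = P.stations.card := by
  have hn : ∀ n, (encNat n).flatMap (fun a => if a = .rbr then [Letter.one] else []) = [] :=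
    fun n => List.flatMap_eq_nil_iff.2 fun a ha => if_neg (ne_bracket_of_mem_encNat ha).2
  rw [ConstraintWord.unaryCard, stations_encode, run_ofLetters, List.flatMap_assoc]
  simp [List.flatMap_append, hn, List.flatMap_assoc, stationList, Function.comp_def]

theorem polyTime_toFinGraph : PolyTime encode FinGraph.encode toFinGraph :=
  ConstraintWord.impl_matrix.polyTime fun P ρ h => by rw [h, matrix_encode]

theorem polyTime_toFinGraph_card : PolyTime encode (encPair FinGraph.encode encNat)
    fun P => (P.toFinGraph, P.stations.card) :=
  (ConstraintWord.impl_matrix.append (ConstraintWord.impl_unaryCard 1).encNat_length).polyTime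
    fun P ρ h => by
      have := length_unaryCard P []
      rw [List.append_nil] at this
      simp only [h, matrix_encode, this]
      rfl

/-- Constraint codes contain no brackets, so behind the stations the first closing bracket ends the
instance, and `after .rbr` isolates the answer. -/
theorem rest_encode_eq (P : BRP) (y : List Letter) : ∃ x, Letter.rbr ∉ x ∧
    ConstraintWord.rest (P.encode ++ y) = x ++ .rbr :: y := by
  refine ⟨.lbr :: P.interferenceList.flatMap encConstraint, ?_, by simp [rest_encode, encList]⟩
  simp only [List.mem_cons, reduceCtorEq, false_or, List.mem_flatMap, not_exists, not_and]
  exact fun i _ => rbr_notMem_encConstraint i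

theorem polyTime_compare_nat : PolyTime (encPair encode encNat) encBool
    fun p : BRP × ℕ => decide (p.2 = p.1.stations.card) := by
  refine Impl.polyTime (Impl.ite_eq (((Impl.var 0).transduce (stationScan fun q a =>
    if q = 3 then [a] else [])).transduce (after .rbr fun a => [a]))
    (ConstraintWord.impl_unaryCard 1).encNat_length (Impl.lit [.one]) (Impl.lit [.zero])) ?_
  rintro ⟨P, n⟩ ρ h
  obtain ⟨x, hx, hr⟩ := rest_encode_eq P (encNat n)
  rw [ConstraintWord.rest] at hr
  simp only [h, encPair, hr, run_after hx, length_unaryCard, List.flatMap_singleton', encNat_inj]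
  by_cases hn : n = P.stations.card <;> simp [hn, encBool, Letter.ofBool]

/-- Each element of the returned set contributes exactly one comma, so its cardinality is obtained
by counting commas. -/
theorem polyTime_compare_card : PolyTime (encPair encode encFinset) encBool
    fun p : BRP × Finset ℕ => decide (p.2.card = p.1.stations.card) := by
  refine Impl.polyTime (Impl.ite_eq (((Impl.var 0).transduce (stationScan fun q a =>
    if q = 3 then [a] else [])).transduce
      (after .rbr fun a => if a = .comma then [.one] else [])).encNat_length
    (ConstraintWord.impl_unaryCard 1).encNat_length (Impl.lit [.one]) (Impl.lit [.zero])) ?_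
  rintro ⟨P, U⟩ ρ h
  obtain ⟨x, hx, hr⟩ := rest_encode_eq P (encFinset U)
  rw [ConstraintWord.rest] at hr
  have hb : ∀ l : List Bool, (l.map Letter.ofBool).flatMap
      (fun a => if a = .comma then [Letter.one] else []) = [] := by
    intro l
    simp only [List.flatMap_eq_nil_iff, List.mem_map]
    rintro _ ⟨_ | _, -, rfl⟩ <;> simp [Letter.ofBool]
  have hU : ((encFinset U).flatMap fun a => if a = .comma then [Letter.one] else []).length =
      U.card := by
    simp [encFinset, encList, List.flatMap_append, List.flatMap_assoc, encNat, hb]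
  simp only [h, encPair, hr, run_after hx, length_unaryCard, hU, encNat_inj]
  by_cases hn : U.card = P.stations.card <;> simp [hn, encBool, Letter.ofBool]

/-! ### Feasible assignments and independent sets -/

/-- Two different vertices of one station have different channels and are joined by an at-most
constraint. -/
theorem injOn_station_of_isIndepSet (P : BRP) {T : Finset P.vertices}
    (hT : P.constraintGraph.IsIndepSet T) :
    Set.InjOn (fun v : P.vertices => v.1.1) T := by
  intro v hv w hw hvw
  by_contra hne
  refine hT hv hw hne (.inr (.inr ⟨hvw, fun h => hne (Subtype.ext (Prod.ext hvw h))⟩))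

theorem indepNum_le (P : BRP) : P.constraintGraph.indepNum ≤ P.stations.card := by
  obtain ⟨T, hT⟩ := P.constraintGraph.exists_isNIndepSet_indepNum
  rw [← hT.card_eq]
  exact Finset.card_le_card_of_injOn _ (fun v _ => (mem_vertices.1 v.2).1)
    (injOn_station_of_isIndepSet P hT.isIndepSet)

/-- An assignment becomes the set of its pairs `(s, f s)`; a maximum independent set that is large
enough is read back as an assignment. -/
theorem feasible_iff (P : BRP) :
    P.BRPF.Nonempty ↔ P.stations.card ≤ P.constraintGraph.indepNum := by
  constructor
  · rintro ⟨f, hf, hd⟩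
    let e : P.stations ↪ P.vertices :=
      ⟨fun s => ⟨(s, f s), mem_vertices.2 ⟨s.2, hd s⟩⟩, fun s t h => by
        simp only [Subtype.mk.injEq, Prod.mk.injEq] at h
        exact Subtype.ext h.1⟩
    have hI : P.constraintGraph.IsIndepSet (Finset.univ.map e : Finset P.vertices) := by
      intro v hv w hw hne hadj
      simp only [Finset.coe_map, Finset.coe_univ, Set.image_univ, Set.mem_range] at hv hw
      obtain ⟨s, rfl⟩ := hv
      obtain ⟨t, rfl⟩ := hw
      rcases hadj with h | h | h
      · exact hf s t _ _ h rfl rfl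
      · exact hf t s _ _ h rfl rfl
      · exact hne (congrArg e (Subtype.ext h.1))
    simpa using hI.card_le_indepNum
  · intro h
    obtain ⟨T, hT⟩ := P.constraintGraph.exists_isNIndepSet_indepNum
    have hinj := injOn_station_of_isIndepSet P hT.isIndepSet
    rw [← hT.card_eq] at h
    -- The stations of `T` are pairwise different and at least as many as there are stations, so
    -- every station occurs.
    have himg : T.image (fun v : P.vertices => v.1.1) = P.stations :=
      Finset.eq_of_subset_of_card_le
        (Finset.image_subset_iff.2 fun v _ => (mem_vertices.1 v.2).1)
        (by rwa [Finset.card_image_of_injOn hinj])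
    have hex : ∀ s : P.stations, ∃ v ∈ T, v.1.1 = s := fun s => by
      have := himg.ge s.2
      simpa only [Finset.mem_image] using this
    choose g hgT hgs using hex
    refine ⟨fun s => ⟨(g s).1.2, ?_⟩, ?_, ?_⟩
    · have := mem_vertices.1 (g s).2
      exact Finset.mem_biUnion.2 ⟨_, this.1, this.2⟩
    · rintro s₁ s₂ c₁ c₂ hI h₁ h₂
      have e₁ : ((g s₁ : P.vertices) : ℕ × ℕ) = ((s₁ : ℕ), c₁) := Prod.ext (hgs s₁) h₁
      have e₂ : ((g s₂ : P.vertices) : ℕ × ℕ) = ((s₂ : ℕ), c₂) := Prod.ext (hgs s₂) h₂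
      rw [← e₁, ← e₂] at hI
      have hadj : P.constraintGraph.Adj (g s₁) (g s₂) := .inl hI
      exact hT.isIndepSet (hgT s₁) (hgT s₂) hadj.ne hadj
    · intro s
      have := (mem_vertices.1 (g s).2).2
      rwa [hgs] at this

theorem indepNum_toFinGraph (P : BRP) :
    P.toFinGraph.graph.indepNum = P.constraintGraph.indepNum := by
  have key : ∀ {V W : Type} [Finite V] [Finite W] {G : SimpleGraph V} {H : SimpleGraph W},
      (G ≃g H) → G.indepNum ≤ H.indepNum := by
    intro V W _ _ G H e
    obtain ⟨T, hT⟩ := G.exists_isNIndepSet_indepNum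
    have : H.IsIndepSet (T.map e.toEquiv.toEmbedding : Finset W) := by
      intro v hv w hw hne hadj
      simp only [Finset.coe_map, Set.mem_image] at hv hw
      obtain ⟨v, hv, rfl⟩ := hv
      obtain ⟨w, hw, rfl⟩ := hw
      exact hT.isIndepSet hv hw (fun h => hne (by rw [h])) (e.map_adj_iff.1 hadj)
    rw [← hT.card_eq]
    simpa using this.card_le_indepNum
  exact le_antisymm (key P.toFinGraphIso) (key P.toFinGraphIso.symm)

/-- The upper bound `indepNum_le` turns the inequality into the equality tested by the answer maps.
-/
theorem feasible_iff_indepNum_eq (P : BRP) :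
    P.toFinGraph.graph.indepNum = P.stations.card ↔ P.BRPF.Nonempty := by
  rw [feasible_iff, indepNum_toFinGraph]
  exact ⟨fun h => h.ge, fun h => le_antisymm P.indepNum_le h⟩

end BRP

theorem mainTheorem4 :
    ∃ f : BRP → FinGraph,
      (∀ P : BRP, Nonempty (P.constraintGraph ≃g (f P).graph)) ∧
      IsPolyTimeReduction brpFeasibility.toProblem mispOptimization f
        (fun p : BRP × Finset ℕ => decide (p.2.card = p.1.stations.card)) ∧
      IsPolyTimeReduction brpFeasibility.toProblem mispEvaluation f
        (fun p : BRP × ℕ => decide (p.2 = p.1.stations.card)) ∧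
      IsPolyTimeManyOneReduction brpFeasibility mispRecognition
        (fun P : BRP => (f P, P.stations.card)) := by
  refine ⟨BRP.toFinGraph, fun P => ⟨P.toFinGraphIso.symm⟩,
    ⟨BRP.polyTime_toFinGraph, BRP.polyTime_compare_card, ?_⟩,
    ⟨BRP.polyTime_toFinGraph, BRP.polyTime_compare_nat, ?_⟩, BRP.polyTime_toFinGraph_card, ?_⟩
  -- Only the cardinality of the returned set matters; its being independent is not needed again.
  · rintro P U ⟨T, -, hT, rfl⟩
    refine decide_eq_true_iff.trans ?_
    rw [Finset.card_map, hT]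
    exact P.feasible_iff_indepNum_eq
  · rintro P a (rfl : a = _)
    exact decide_eq_true_iff.trans P.feasible_iff_indepNum_eq
  · intro P
    refine P.feasible_iff.trans ?_
    rw [← P.indepNum_toFinGraph]
    rfl
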